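/- **Setting.** Let $M$ be an oriented Riemannian surface with Levi-Civita connection, let $E\to M$ be an oriented real vector bundle of rank $q$ with a fibre metric and a compatible connection, let spin structures $\tilde Q_M$, $\tilde Q_E$ of $TM$ and $E$ be given, and put $n=2+q$, $\tilde Q=\tilde Q_M\times_M\tilde Q_E$. Let $Cl_n$ be the real Clifford algebra of $\mathbb R^n$ (with $v\cdot v=-|v|^2$), $\tau$ its anti-automorphism reversing products of vectors, and let $\Sigma=\tilde Q\times_\rho Cl_n$, $U\Sigma=\tilde Q\times_\rho Spin(n)$, where $\rho$ is left multiplication via $Spin(2)\times Spin(q)\to Spin(n)$, with the connection $\nabla$ induced by the spinorial connections. $Cl(TM\oplus E)$ acts on $\Sigma$ by Clifford multiplication, and $\langle\langle\varphi,\psi\rangle\rangle:=\tau[\psi][\varphi]\in Cl_n$, where $[\varphi],[\psi]$ represent $\varphi,\psi$ in any spinorial frame. Let $B:TM\times TM\to E$ be bilinear and symmetric, let $\vec H=\frac12\sum_{j=1}^2B(e_j,e_j)$ be the mean curvature vector, and let $\varphi\in\Gamma(U\Sigma)$ be a smooth solution of $\nabla_X\varphi=-\frac12\sum_{j=1}^2e_j\cdot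 B(X,e_j)\cdot\varphi$ for all $X\in TM$, where $(e_1,e_2)$ is an orthonormal basis of the tangent plane. (This is the spinorial description of an isometric immersion of $M$ in $\mathbb R^n$ with normal bundle $E$ and second fundamental form $B$.) Let $\xi(X)=\langle\langle X\cdot\varphi,\varphi\rangle\rangle$ for $X\in TM\oplus E$; it takes its values in $\mathbb R^n\subset Cl_n$. A map $F$ into $\mathbb R^n$ with $dF=\xi$ on $TM$ is written $F=\int\xi$. Let $J$ be the complex structure of $M$ (rotation by $+\pi/2$) and put $\tilde\xi(X)=\xi(X)-i\,\xi(JX)\in\mathbb C^n$ for $X\in TM$. A complex parameter $z$ is a smooth local coordinate $z:U\to\mathbb C$, $U\subset M$ open, with $dz\circ J=i\,dz$. **Proposition.** 1. $\tilde\xi$ is a smooth $\mathbb C$-linear $1$-form, and for every complex parameter $z$ in which the metric is $\mu^2\,dz\,d\bar z$, $$d\tilde\xi=-\mu^2\,\langle\langle\vec H\cdot\varphi,\varphi\rangle\rangle\,dz\wedge d\bar z .$$ 2. $\tilde\xi$ is closed if and only if $\vec H=0$ on $M$. If it is closed, it is holomorphic: in every complex parameter $z$ one has $\tilde\xi=\tilde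 f\,dz$ with $\tilde f$ holomorphic. 3. If $\vec H=0$, then $F=\mathrm{Re}\int\tilde f(z)\,dz$ with $\tilde f$ holomorphic: for every complex parameter $z:U\to\mathbb C$, every $F:U\to\mathbb R^n$ with $dF=\xi$ and every $C^1$ path $\gamma$ in $z(U)$ from $a$ to $b$, $F(z^{-1}(b))=F(z^{-1}(a))+\mathrm{Re}\int_\gamma\tilde f\,dz$. If moreover $M$ is simply connected, there is a global map $G:M\to\mathbb C^n$ with $dG=\tilde\xi$, which in every complex parameter $z$ is holomorphic with $dG/dz=\tilde f$, and every $F:M\to\mathbb R^n$ with $dF=\xi$ equals $\mathrm{Re}\,G$ up to an additive constant. -/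

import Mathlib

noncomputable section

namespace SpinSurface

open scoped Manifold ContDiff Bundle

/-- `ℝⁿ` with its Euclidean norm. -/
abbrev Eu (n : ℕ) : Type := EuclideanSpace ℝ (Fin n)

/-- The quadratic form `-|v|²` on `ℝⁿ`: the Clifford convention is `v · v = -|v|²`. -/
def negSq (n : ℕ) : QuadraticForm ℝ (Eu n) :=
  -LinearMap.BilinMap.toQuadraticMap (innerₗ (Eu n))

theorem negSq_apply {n : ℕ} (v : Eu n) : negSq n v = -‖v‖ ^ 2 := by
  simp [negSq]

/-- The real Clifford algebra `Clₙ`. -/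
abbrev Cl (n : ℕ) : Type := CliffordAlgebra (negSq n)

/-- The group `Spin(n) ⊆ Clₙ`. -/
abbrev Spin (n : ℕ) : Type := spinGroup (negSq n)

/-- The inclusion `ℝⁿ ⊆ Clₙ`. -/
abbrev vec {n : ℕ} (v : Eu n) : Cl n := CliffordAlgebra.ι (negSq n) v

/-- The projection of `Clₙ` onto `ℝⁿ ⊆ Clₙ` (a left inverse of `vec`). -/
def toVec (n : ℕ) : Cl n →ₗ[ℝ] Eu n :=
  ExteriorAlgebra.ιInv ∘ₗ (CliffordAlgebra.equivExterior (negSq n)).toLinearMap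

theorem toVec_vec {n : ℕ} (v : Eu n) : toVec n (vec v) = v := by
  simp [toVec, CliffordAlgebra.equivExterior, vec, ExteriorAlgebra.ι_leftInverse v]

theorem finite_exteriorAlgebra (n : ℕ) : Module.Finite ℝ (ExteriorAlgebra ℝ (Eu n)) := by
  have h1 : iSup (fun i : ℕ => ⋀[ℝ]^i (Eu n)) = ⊤ :=
    (DirectSum.Decomposition.isInternal (fun i : ℕ => ⋀[ℝ]^i (Eu n))).submodule_iSup_eq_top
  have h2 : ∀ i : ℕ, n < i → ⋀[ℝ]^i (Eu n) = ⊥ := by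
    intro i hi
    rw [← Submodule.finrank_eq_zero (R := ℝ), exteriorPower.finrank_eq]
    simpa using Nat.choose_eq_zero_of_lt hi
  have h3 : (⨆ i : Fin (n + 1), ⋀[ℝ]^(i : ℕ) (Eu n)) = ⊤ := by
    rw [eq_top_iff, ← h1]
    refine iSup_le fun i => ?_
    rcases Nat.lt_or_ge n i with h | h
    · rw [h2 i h]; exact bot_le
    · exact le_iSup (fun i : Fin (n + 1) => ⋀[ℝ]^(i : ℕ) (Eu n)) ⟨i, by omega⟩
  have h4 : Module.Finite ℝ (⨆ i : Fin (n + 1), ⋀[ℝ]^(i : ℕ) (Eu n) : Submodule ℝ _) :=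
    Submodule.finite_iSup _
  rw [h3] at h4
  exact Module.Finite.equiv (Submodule.topEquiv)

instance instFiniteCl (n : ℕ) : Module.Finite ℝ (Cl n) :=
  haveI := finite_exteriorAlgebra n
  Module.Finite.equiv (CliffordAlgebra.equivExterior (negSq n)).symm

/-- `Clₙ` is a finite dimensional real vector space; it gets the norm of some basis. Only the
topology and the smooth structure are used, and these do not depend on the basis. -/
instance instNormedAddCommGroupCl (n : ℕ) : NormedAddCommGroup (Cl n) :=
  NormedAddCommGroup.induced (Cl n) _ (Module.finBasis ℝ (Cl n)).equivFun
    (Module.finBasis ℝ (Cl n)).equivFun.injective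

instance instNormedSpaceCl (n : ℕ) : NormedSpace ℝ (Cl n) :=
  NormedSpace.induced ℝ (Cl n) _ (Module.finBasis ℝ (Cl n)).equivFun

/-- The anti-automorphism `τ` of `Clₙ` reversing products of vectors. -/
abbrev tau {n : ℕ} : Cl n →ₗ[ℝ] Cl n := CliffordAlgebra.reverse

theorem star_eq_tau {n : ℕ} (g : Spin n) : star (g : Cl n) = tau (g : Cl n) := by
  rw [CliffordAlgebra.star_def, spinGroup.involute_eq g.2]

theorem tau_mul_self {n : ℕ} (g : Spin n) : tau (g : Cl n) * (g : Cl n) = 1 := by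
  rw [← star_eq_tau]; exact spinGroup.star_mul_self_of_mem g.2

theorem mul_tau_self {n : ℕ} (g : Spin n) : (g : Cl n) * tau (g : Cl n) = 1 := by
  rw [← star_eq_tau]; exact spinGroup.mul_star_self_of_mem g.2

/-- The covering map `Spin(n) → SO(n)`, `g ↦ (v ↦ g v g⁻¹)` (note `τ(g) = g⁻¹` on `Spin(n)`). -/
def rot {n : ℕ} (g : Spin n) : Eu n →ₗ[ℝ] Eu n :=
  toVec n ∘ₗ LinearMap.mulRight ℝ (tau (g : Cl n)) ∘ₗ LinearMap.mulLeft ℝ (g : Cl n) ∘ₗ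
    CliffordAlgebra.ι (negSq n)

theorem vec_rot {n : ℕ} (g : Spin n) (v : Eu n) :
    vec (rot g v) = (g : Cl n) * vec v * tau (g : Cl n) := by
  have h : (ConjAct.toConjAct (spinGroup.toUnits g)) • vec v ∈
      LinearMap.range (CliffordAlgebra.ι (negSq n)) :=
    spinGroup.conjAct_smul_ι_mem_range_ι g.2 v
  rw [ConjAct.units_smul_def] at h
  obtain ⟨w, hw⟩ := h
  have hw' : vec w = (g : Cl n) * vec v * tau (g : Cl n) := by
    rw [← star_eq_tau]; exact hw
  simp only [rot, LinearMap.comp_apply, LinearMap.mulLeft_apply, LinearMap.mulRight_apply]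
  rw [← hw', toVec_vec]

/-- `ℝᵖ → ℝᵖ ⊕ ℝ^q = ℝ^(p+q)`. -/
def inclL (p q : ℕ) : Eu p →ₗ[ℝ] Eu (p + q) where
  toFun v := WithLp.toLp 2 (Fin.append v.ofLp 0)
  map_add' v w := by
    ext i; refine Fin.addCases (fun i => ?_) (fun i => ?_) i <;> simp
  map_smul' c v := by
    ext i; refine Fin.addCases (fun i => ?_) (fun i => ?_) i <;> simp

/-- `ℝ^q → ℝᵖ ⊕ ℝ^q = ℝ^(p+q)`. -/
def inclR (p q : ℕ) : Eu q →ₗ[ℝ] Eu (p + q) where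
  toFun v := WithLp.toLp 2 (Fin.append 0 v.ofLp)
  map_add' v w := by
    ext i; refine Fin.addCases (fun i => ?_) (fun i => ?_) i <;> simp
  map_smul' c v := by
    ext i; refine Fin.addCases (fun i => ?_) (fun i => ?_) i <;> simp

/-- `Cl_p → Cl_(p+q)`. -/
def clL (p q : ℕ) : Cl p →ₐ[ℝ] Cl (p + q) :=
  CliffordAlgebra.map ⟨inclL p q, fun v => by
    simp [negSq, EuclideanSpace.norm_sq_eq, Fin.sum_univ_add, inclL]⟩

/-- `Cl_q → Cl_(p+q)`. -/
def clR (p q : ℕ) : Cl q →ₐ[ℝ] Cl (p + q) :=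
  CliffordAlgebra.map ⟨inclR p q, fun v => by
    simp [negSq, EuclideanSpace.norm_sq_eq, Fin.sum_univ_add, inclR]⟩

theorem clL_vec (p q : ℕ) (v : Eu p) : clL p q (vec v) = vec (inclL p q v) := by
  simp only [clL, vec, CliffordAlgebra.map_apply_ι]; rfl

theorem clR_vec (p q : ℕ) (v : Eu q) : clR p q (vec v) = vec (inclR p q v) := by
  simp only [clR, vec, CliffordAlgebra.map_apply_ι]; rfl

theorem tau_clL (p q : ℕ) (a : Cl p) : tau (clL p q a) = clL p q (tau a) := by
  induction a using CliffordAlgebra.induction with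
  | algebraMap r => simp
  | ι x => simp [clL]
  | mul a b ha hb => simp_all
  | add a b ha hb => simp_all

theorem tau_clR (p q : ℕ) (a : Cl q) : tau (clR p q a) = clR p q (tau a) := by
  induction a using CliffordAlgebra.induction with
  | algebraMap r => simp
  | ι x => simp [clR]
  | mul a b ha hb => simp_all
  | add a b ha hb => simp_all

theorem vec_anticomm (p q : ℕ) (v : Eu p) (w : Eu q) :
    vec (inclL p q v) * vec (inclR p q w) = -(vec (inclR p q w) * vec (inclL p q v)) := by
  rw [eq_neg_iff_add_eq_zero, CliffordAlgebra.ι_mul_ι_add_swap, QuadraticMap.polar]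
  simp only [negSq_apply, EuclideanSpace.norm_sq_eq, Fin.sum_univ_add]
  simp [inclL, inclR]

theorem even_clL_comm {p q : ℕ} (g : Spin p) (w : Eu q) :
    clL p q g * vec (inclR p q w) = vec (inclR p q w) * clL p q g := by
  have h := spinGroup.mem_even g.2
  refine CliffordAlgebra.even_induction (Q := negSq p)
    (motive := fun x _ => clL p q x * vec (inclR p q w) = vec (inclR p q w) * clL p q x)
    ?_ ?_ ?_ (g : Cl p) h
  · intro r
    simpa using Algebra.commutes r _
  · intro x y hx hy h1 h2
    simp only [map_add, add_mul, mul_add, h1, h2]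
  · intro a b x hx h1
    have e : clL p q (vec a * vec b * x) =
        vec (inclL p q a) * vec (inclL p q b) * clL p q x := by
      rw [map_mul, map_mul, clL_vec, clL_vec]
    rw [e, mul_assoc, h1, ← mul_assoc, ← mul_assoc, mul_assoc _ (vec (inclL p q b)),
      vec_anticomm, mul_neg, ← mul_assoc, vec_anticomm]
    simp [mul_assoc]

theorem even_clR_comm {p q : ℕ} (g : Spin q) (w : Eu p) :
    clR p q g * vec (inclL p q w) = vec (inclL p q w) * clR p q g := by
  have h := spinGroup.mem_even g.2
  refine CliffordAlgebra.even_induction (Q := negSq q)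
    (motive := fun x _ => clR p q x * vec (inclL p q w) = vec (inclL p q w) * clR p q x)
    ?_ ?_ ?_ (g : Cl q) h
  · intro r
    simpa using Algebra.commutes r _
  · intro x y hx hy h1 h2
    simp only [map_add, add_mul, mul_add, h1, h2]
  · intro a b x hx h1
    have e : clR p q (vec a * vec b * x) =
        vec (inclR p q a) * vec (inclR p q b) * clR p q x := by
      rw [map_mul, map_mul, clR_vec, clR_vec]
    have a1 : ∀ v, vec (inclR p q v) * vec (inclL p q w)
        = -(vec (inclL p q w) * vec (inclR p q v)) := fun v => by
      rw [vec_anticomm, neg_neg]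
    rw [e, mul_assoc, h1, ← mul_assoc, ← mul_assoc, mul_assoc _ (vec (inclR p q b)),
      a1, mul_neg, ← mul_assoc, a1]
    simp [mul_assoc]

/-- The natural map `Spin(p) × Spin(q) → Spin(p+q) ⊆ Cl_(p+q)`. -/
def spinProd {p q : ℕ} (g : Spin p) (h : Spin q) : Cl (p + q) := clL p q g * clR p q h

theorem tau_spinProd_mul {p q : ℕ} (g : Spin p) (h : Spin q) :
    tau (spinProd g h) * spinProd g h = 1 := by
  have e : tau (spinProd g h) = clR p q (tau (h : Cl q)) * clL p q (tau (g : Cl p)) := by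
    rw [spinProd, CliffordAlgebra.reverse.map_mul, tau_clL, tau_clR]
  rw [e, spinProd, mul_assoc, ← mul_assoc (clL p q _) (clL p q _), ← map_mul, tau_mul_self,
    map_one, one_mul, ← map_mul, tau_mul_self, map_one]

theorem vec_rot_prod {p q : ℕ} (g : Spin p) (h : Spin q) (v : Eu p) (w : Eu q) :
    spinProd g h * vec (inclL p q v + inclR p q w) * tau (spinProd g h) =
      vec (inclL p q (rot g v) + inclR p q (rot h w)) := by
  have e : tau (spinProd g h) = clR p q (tau (h : Cl q)) * clL p q (tau (g : Cl p)) := by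
    rw [spinProd, CliffordAlgebra.reverse.map_mul, tau_clL, tau_clR]
  have hR : clR p q h * clR p q (tau (h : Cl q)) = 1 := by
    rw [← map_mul, mul_tau_self, map_one]
  have hL : clL p q g * clL p q (tau (g : Cl p)) = 1 := by
    rw [← map_mul, mul_tau_self, map_one]
  have h1 : clR p q h * vec (inclL p q v) * clR p q (tau (h : Cl q)) = vec (inclL p q v) := by
    rw [even_clR_comm, mul_assoc, hR, mul_one]
  have h2 : clL p q g * vec (inclL p q v) * clL p q (tau (g : Cl p)) =
      vec (inclL p q (rot g v)) := by
    rw [← clL_vec, ← clL_vec, vec_rot, map_mul, map_mul]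
  have h3 : clR p q h * vec (inclR p q w) * clR p q (tau (h : Cl q)) =
      vec (inclR p q (rot h w)) := by
    rw [← clR_vec, ← clR_vec, vec_rot, map_mul, map_mul]
  have h4 : clL p q g * vec (inclR p q (rot h w)) * clL p q (tau (g : Cl p)) =
      vec (inclR p q (rot h w)) := by
    rw [even_clL_comm, mul_assoc, hL, mul_one]
  have key : ∀ x : Cl (p + q), spinProd g h * x * tau (spinProd g h) =
      clL p q g * (clR p q h * x * clR p q (tau (h : Cl q))) * clL p q (tau (g : Cl p)) := by
    intro x; rw [e, spinProd]; simp only [mul_assoc]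
  have hadd : ∀ a b : Eu (p + q), vec (a + b) = vec a + vec b := fun a b => map_add _ a b
  rw [key, hadd, hadd, mul_add, add_mul, mul_add, add_mul, h1, h3, h2, h4]


/-- `ℂⁿ` with its Hermitian norm. -/
abbrev Ec (n : ℕ) : Type := EuclideanSpace ℂ (Fin n)

/-- The inclusion `ℝⁿ ⊆ ℂⁿ`. -/
def toC (n : ℕ) : Eu n →ₗ[ℝ] Ec n where
  toFun v := WithLp.toLp 2 fun j => (v j : ℂ)
  map_add' v w := by ext j; simp
  map_smul' c v := by ext j; simp

/-- The real part `ℂⁿ → ℝⁿ`. -/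
def reC {n : ℕ} (v : Ec n) : Eu n := WithLp.toLp 2 fun j => (v j).re

open Bundle

section Geometry

variable {M : Type*} [TopologicalSpace M] [ChartedSpace (Eu 2) M]

/-- A spin structure on an oriented Riemannian vector bundle `V` of rank `k` over `M`: a principal
`Spin(k)`-bundle `P → M` (right action `act`) with a fibre preserving map `frame` to the positively
oriented orthonormal frames of `V`, equivariant for `Spin(k) → SO(k)`. Regarding a frame as an
isometry `ℝᵏ → V x`, equivariance reads `frame (u · g) = frame u ∘ rot g`.
`locallyTrivial` says that `P` has equivariant local trivializations whose unit sections `s` map to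
smooth local frames of `V` (this also says that the orientation `o` is continuous). -/
structure SpinStructure (k : ℕ) (V : M → Type*)
    [TopologicalSpace (TotalSpace (Eu k) V)]
    [∀ x, NormedAddCommGroup (V x)] [∀ x, InnerProductSpace ℝ (V x)] [FiberBundle (Eu k) V]
    (o : ∀ x, Orientation ℝ (V x) (Fin k)) where
  P : M → Type*
  top : TopologicalSpace (TotalSpace (Spin k) P)
  act : ∀ {x}, P x → Spin k → P x
  act_one : ∀ {x} (u : P x), act u 1 = u
  act_mul : ∀ {x} (u : P x) (g h : Spin k), act u (g * h) = act (act u g) h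
  frame : ∀ {x}, P x → OrthonormalBasis (Fin k) ℝ (V x)
  frame_orientation : ∀ {x} (u : P x), (frame u).toBasis.orientation = o x
  frame_act : ∀ {x} (u : P x) (g : Spin k) (v : Eu k),
    (frame (act u g)).repr.symm v = (frame u).repr.symm (rot g v)
  locallyTrivial : ∀ x₀ : M,
    ∃ (e : Trivialization (Spin k) (π (Spin k) P)) (s : ∀ x, P x),
      x₀ ∈ e.baseSet ∧
      (∀ x ∈ e.baseSet, ∀ (u : P x) (g : Spin k), (e ⟨x, act u g⟩).2 = (e ⟨x, u⟩).2 * g) ∧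
      (∀ x ∈ e.baseSet, (e ⟨x, s x⟩).2 = 1) ∧
      ∀ j, ContMDiffOn (𝓡 2) ((𝓡 2).prod 𝓘(ℝ, Eu k)) ∞
        (fun x => TotalSpace.mk' (Eu k) x (frame (s x) j)) e.baseSet

namespace SpinStructure

variable {k : ℕ} {V : M → Type*}
    [TopologicalSpace (TotalSpace (Eu k) V)]
    [∀ x, NormedAddCommGroup (V x)] [∀ x, InnerProductSpace ℝ (V x)] [FiberBundle (Eu k) V]
    {o : ∀ x, Orientation ℝ (V x) (Fin k)}

/-- `s` is, over the open set `U`, a local section of `P` lying above a smooth frame of `V`. -/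
structure IsLocalFrame (S : SpinStructure k V o) (s : ∀ x, S.P x) (U : Set M) : Prop where
  isOpen : IsOpen U
  continuousOn : letI := S.top; ContinuousOn (fun x => TotalSpace.mk' (Spin k) x (s x)) U
  smooth : ∀ j, ContMDiffOn (𝓡 2) ((𝓡 2).prod 𝓘(ℝ, Eu k)) ∞
        (fun x => TotalSpace.mk' (Eu k) x (S.frame (s x) j)) U

theorem nonempty (S : SpinStructure k V o) (x : M) : Nonempty (S.P x) :=
  ⟨(S.locallyTrivial x).choose_spec.choose x⟩

theorem transitive (S : SpinStructure k V o) {x : M} (u u' : S.P x) :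
    ∃ g, u' = S.act u g := by
  let _ := S.top
  obtain ⟨e, s, hx, he, -⟩ := S.locallyTrivial x
  refine ⟨(e ⟨x, u⟩).2⁻¹ * (e ⟨x, u'⟩).2, ?_⟩
  have h1 := he x hx u ((e ⟨x, u⟩).2⁻¹ * (e ⟨x, u'⟩).2)
  rw [mul_inv_cancel_left] at h1
  have m : ∀ w : S.P x, (⟨x, w⟩ : TotalSpace (Spin k) S.P) ∈ e.source := fun w =>
    e.mem_source.2 hx
  have h2 := e.injOn (m u') (m (S.act u ((e ⟨x, u⟩).2⁻¹ * (e ⟨x, u'⟩).2)))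
    (Prod.ext ((e.coe_fst (m _)).trans (e.coe_fst (m (S.act u _))).symm) h1.symm)
  simpa using h2

end SpinStructure

variable [IsManifold (𝓡 2) ∞ M]
  [RiemannianBundle (fun x : M => TangentSpace (𝓡 2) x)]
  {oM : ∀ x : M, Orientation ℝ (TangentSpace (𝓡 2) x) (Fin 2)}

variable {q : ℕ} {E : M → Type*}
    [TopologicalSpace (TotalSpace (Eu q) E)]
    [∀ x, NormedAddCommGroup (E x)] [∀ x, InnerProductSpace ℝ (E x)] [FiberBundle (Eu q) E]
    {oE : ∀ x, Orientation ℝ (E x) (Fin q)}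

variable (SM : SpinStructure 2 (fun x : M => TangentSpace (𝓡 2) x) oM)
  (SE : SpinStructure q E oE)

/-- A smooth section `φ` of `Σ = Q̃ ×_ρ Clₙ`, `Q̃ = Q̃_M ×_M Q̃_E`, `n = 2 + q`, where `ρ` is left
multiplication by `Spin(2) × Spin(q) → Spin(n)`: `coord u w = [φ] ∈ Clₙ` represents `φ` in the
spinorial frame `(u, w) ∈ Q̃`, so that `[φ]` in `(u·g, w·h)` is `(gh)⁻¹[φ]`. -/
structure SpinorField where
  coord : ∀ {x : M}, SM.P x → SE.P x → Cl (2 + q)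
  equivariant : ∀ {x : M} (u : SM.P x) (w : SE.P x) (g : Spin 2) (h : Spin q),
    spinProd g h * coord (SM.act u g) (SE.act w h) = coord u w
  smooth : ∀ (s : ∀ x, SM.P x) (t : ∀ x, SE.P x) (U : Set M),
    SM.IsLocalFrame s U → SE.IsLocalFrame t U →
      ContMDiffOn (𝓡 2) 𝓘(ℝ, Cl (2 + q)) ∞ (fun x => coord (s x) (t x)) U

/-- The directional derivative `∂_X f` (so for `f = z` this is `dz(X)`). -/
def dirDeriv {W : Type*} [NormedAddCommGroup W] [NormedSpace ℝ W] (f : M → W) (x : M)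
    (X : TangentSpace (𝓡 2) x) : W :=
  mfderiv (𝓡 2) 𝓘(ℝ, W) f x X

instance instFiniteTangent (x : M) : FiniteDimensional ℝ (TangentSpace (𝓡 2) x) :=
  inferInstanceAs (FiniteDimensional ℝ (Eu 2))

/-- The complex structure of an oriented Riemannian surface: rotation by `+π/2`. -/
def J (o : ∀ x : M, Orientation ℝ (TangentSpace (𝓡 2) x) (Fin 2)) (x : M) :
    TangentSpace (𝓡 2) x →ₗ[ℝ] TangentSpace (𝓡 2) x :=
  haveI : Fact (Module.finrank ℝ (TangentSpace (𝓡 2) x) = 2) := ⟨finrank_euclideanSpace_fin⟩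
  (o x).rightAngleRotation.toLinearEquiv.toLinearMap

variable {SM SE}

/-- `[v] ∈ ℝⁿ`: the coordinates of `v ∈ T_xM ⊕ E_x` in the frame below `(u, w)`. -/
def coordVec {x : M} (u : SM.P x) (w : SE.P x) :
    TangentSpace (𝓡 2) x × E x →ₗ[ℝ] Eu (2 + q) :=
  LinearMap.coprod (inclL 2 q ∘ₗ (SM.frame u).repr.toLinearEquiv.toLinearMap)
    (inclR 2 q ∘ₗ (SE.frame w).repr.toLinearEquiv.toLinearMap)

/-- `⟨⟨a, b⟩⟩ = τ(b) a`. -/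
def bracket {n : ℕ} (a b : Cl n) : Cl n := tau b * a

theorem vec_coordVec_act {x : M} (u : SM.P x) (w : SE.P x) (g : Spin 2) (h : Spin q)
    (v : TangentSpace (𝓡 2) x × E x) :
    spinProd g h * vec (coordVec (SM.act u g) (SE.act w h) v) * tau (spinProd g h) =
      vec (coordVec u w v) := by
  have h1 : rot g ((SM.frame (SM.act u g)).repr v.1) = (SM.frame u).repr v.1 := by
    rw [← LinearIsometryEquiv.symm_apply_eq, ← SM.frame_act]; simp
  have h2 : rot h ((SE.frame (SE.act w h)).repr v.2) = (SE.frame w).repr v.2 := by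
    rw [← LinearIsometryEquiv.symm_apply_eq, ← SE.frame_act]; simp
  have e : ∀ (u : SM.P x) (w : SE.P x), coordVec u w v =
    inclL 2 q ((SM.frame u).repr v.1) + inclR 2 q ((SE.frame w).repr v.2) := fun _ _ => rfl
  rw [e, e, vec_rot_prod, h1, h2]

namespace SpinorField

variable (φ : SpinorField SM SE)

/-- `⟨⟨v · φ, φ⟩⟩ ∈ Clₙ`, computed in any spinorial frame at `x` (see `xiCl_eq`). -/
def xiCl (x : M) (v : TangentSpace (𝓡 2) x × E x) : Cl (2 + q) :=
  let u := Classical.choice (SM.nonempty x)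
  let w := Classical.choice (SE.nonempty x)
  bracket (vec (coordVec u w v) * φ.coord u w) (φ.coord u w)

/-- The value does not depend on the spinorial frame. -/
theorem xiCl_eq {x : M} (u : SM.P x) (w : SE.P x) (v : TangentSpace (𝓡 2) x × E x) :
    φ.xiCl x v = bracket (vec (coordVec u w v) * φ.coord u w) (φ.coord u w) := by
  obtain ⟨g, hg⟩ := SM.transitive u (Classical.choice (SM.nonempty x))
  obtain ⟨h, hh⟩ := SE.transitive w (Classical.choice (SE.nonempty x))
  simp only [xiCl]
  rw [hg, hh, ← φ.equivariant u w g h, ← vec_coordVec_act u w g h v]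
  simp only [bracket, CliffordAlgebra.reverse.map_mul]
  generalize φ.coord (SM.act u g) (SE.act w h) = a
  generalize vec (coordVec (SM.act u g) (SE.act w h) v) = b
  have hc := tau_spinProd_mul g h
  generalize spinProd g h = c at *
  rw [mul_assoc (tau a), mul_assoc (c * b), ← mul_assoc (tau c) c a, hc, one_mul,
    mul_assoc c b a, ← mul_assoc (tau c) c, hc, one_mul]

/-- `φ` is a section of `UΣ = Q̃ ×_ρ Spin(n)`. -/
def IsUnit : Prop :=
  ∀ ⦃x : M⦄ (u : SM.P x) (w : SE.P x), φ.coord u w ∈ spinGroup (negSq (2 + q))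

/-- `ξ(v) = ⟨⟨v · φ, φ⟩⟩` as a vector of `ℝⁿ`, see `vec_xi`. -/
def xi (x : M) : TangentSpace (𝓡 2) x × E x →ₗ[ℝ] Eu (2 + q) where
  toFun v := toVec (2 + q) (φ.xiCl x v)
  map_add' v v' := by simp [xiCl, bracket, mul_add, add_mul]
  map_smul' c v := by simp [xiCl, bracket]

/-- For `φ ∈ Γ(UΣ)`, `⟨⟨v · φ, φ⟩⟩` lies in `ℝⁿ ⊆ Clₙ`, and `ξ(v)` is that vector. -/
theorem vec_xi (hφ : φ.IsUnit) (x : M) (v : TangentSpace (𝓡 2) x × E x) :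
    vec (φ.xi x v) = φ.xiCl x v := by
  let u := Classical.choice (SM.nonempty x)
  let w := Classical.choice (SE.nonempty x)
  let a : Spin (2 + q) := ⟨φ.coord u w, hφ u w⟩
  have h := vec_rot a⁻¹ (coordVec u w v)
  have h1 : ((a⁻¹ : Spin (2 + q)) : Cl (2 + q)) = tau (a : Cl (2 + q)) := star_eq_tau a
  rw [h1, CliffordAlgebra.reverse_reverse] at h
  have h2 : φ.xiCl x v = vec (rot a⁻¹ (coordVec u w v)) := by
    rw [h, mul_assoc]; rfl
  change vec (toVec _ (φ.xiCl x v)) = _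
  rw [h2, toVec_vec]

end SpinorField

/-- The `Λ²`-valued local connection form of the spinorial connections in the frame `(s, t)`:
`½ ∑_{a<b} ⟨∇_X e_a, e_b⟩ e_a e_b`, summed over the frame of `TM` and over the frame of `E`. -/
def spinConnection (covM : CovariantDerivative (𝓡 2) (Eu 2) (fun x : M => TangentSpace (𝓡 2) x))
    (covE : CovariantDerivative (𝓡 2) (Eu q) E)
    (s : ∀ x, SM.P x) (t : ∀ x, SE.P x) (x : M) (X : TangentSpace (𝓡 2) x) : Cl (2 + q) :=
  (1 / 2 : ℝ) • (∑ a : Fin 2, ∑ b ∈ Finset.Ioi a,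
    (inner ℝ (covM (fun y => SM.frame (s y) a) x X) (SM.frame (s x) b) : ℝ) •
      (vec (inclL 2 q (EuclideanSpace.single a 1)) * vec (inclL 2 q (EuclideanSpace.single b 1))))
  + (1 / 2 : ℝ) • (∑ a : Fin q, ∑ b ∈ Finset.Ioi a,
    (inner ℝ (covE (fun y => SE.frame (t y) a) x X) (SE.frame (t x) b) : ℝ) •
      (vec (inclR 2 q (EuclideanSpace.single a 1)) * vec (inclR 2 q (EuclideanSpace.single b 1))))

namespace SpinorField

variable (φ : SpinorField SM SE)

/-- `[∇_X φ]` in the local spinorial frame `(s, t)`. -/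
def nabla (covM : CovariantDerivative (𝓡 2) (Eu 2) (fun x : M => TangentSpace (𝓡 2) x))
    (covE : CovariantDerivative (𝓡 2) (Eu q) E)
    (s : ∀ x, SM.P x) (t : ∀ x, SE.P x) (x : M) (X : TangentSpace (𝓡 2) x) : Cl (2 + q) :=
  dirDeriv (fun y => φ.coord (s y) (t y)) x X +
    spinConnection covM covE s t x X * φ.coord (s x) (t x)

/-- The equation `∇_X φ = -½ ∑_j e_j · B(X, e_j) · φ`. -/
def IsKilling (covM : CovariantDerivative (𝓡 2) (Eu 2) (fun x : M => TangentSpace (𝓡 2) x))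
    (covE : CovariantDerivative (𝓡 2) (Eu q) E)
    (B : ∀ x : M, TangentSpace (𝓡 2) x →ₗ[ℝ] TangentSpace (𝓡 2) x →ₗ[ℝ] E x) : Prop :=
  ∀ (s : ∀ x, SM.P x) (t : ∀ x, SE.P x) (U : Set M),
    SM.IsLocalFrame s U → SE.IsLocalFrame t U → ∀ x ∈ U, ∀ X : TangentSpace (𝓡 2) x,
      φ.nabla covM covE s t x X = -(1 / 2 : ℝ) • ∑ j : Fin 2,
        vec (coordVec (s x) (t x) (SM.frame (s x) j, 0)) *
          vec (coordVec (s x) (t x) (0, B x X (SM.frame (s x) j))) * φ.coord (s x) (t x)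

/-- The `ℝⁿ`-valued 1-form `ξ(X) = ⟨⟨X · φ, φ⟩⟩` on `M`. -/
def xiForm (x : M) : TangentSpace (𝓡 2) x →L[ℝ] Eu (2 + q) :=
  LinearMap.toContinuousLinearMap
    (φ.xi x ∘ₗ LinearMap.inl ℝ (TangentSpace (𝓡 2) x) (E x))

/-- The `ℂⁿ`-valued 1-form `ξ̃(X) = ξ(X) - i ξ(JX)` on `M`. -/
def xiTilde (x : M) : TangentSpace (𝓡 2) x →L[ℝ] Ec (2 + q) :=
  LinearMap.toContinuousLinearMap
    (toC (2 + q) ∘ₗ (φ.xiForm x).toLinearMap -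
      Complex.I • (toC (2 + q) ∘ₗ (φ.xiForm x).toLinearMap ∘ₗ J oM x))

end SpinorField

/-- The mean curvature vector `H = ½ ∑_j B(e_j, e_j)`. -/
def meanCurvature (B : ∀ x : M, TangentSpace (𝓡 2) x →ₗ[ℝ] TangentSpace (𝓡 2) x →ₗ[ℝ] E x)
    (x : M) : E x :=
  (1 / 2 : ℝ) • ∑ j, B x (stdOrthonormalBasis ℝ (TangentSpace (𝓡 2) x) j)
    (stdOrthonormalBasis ℝ (TangentSpace (𝓡 2) x) j)

section Forms

variable {W : Type*} [NormedAddCommGroup W] [NormedSpace ℝ W]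

/-- The expression of a 1-form in the preferred chart at `x₀`. -/
def inChart (α : ∀ x : M, TangentSpace (𝓡 2) x →L[ℝ] W) (x₀ : M) (y : Eu 2) : Eu 2 →L[ℝ] W :=
  (α ((extChartAt (𝓡 2) x₀).symm y)).comp
    (mfderiv 𝓘(ℝ, Eu 2) (𝓡 2) (extChartAt (𝓡 2) x₀).symm y)

/-- The 1-form is smooth. -/
def IsSmoothForm (α : ∀ x : M, TangentSpace (𝓡 2) x →L[ℝ] W) : Prop :=
  ∀ x₀, ContDiffOn ℝ ∞ (inChart α x₀) (extChartAt (𝓡 2) x₀).target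

/-- The exterior derivative `dα(X, Y)` of a 1-form, computed in the preferred chart at `x`. -/
def dForm (α : ∀ x : M, TangentSpace (𝓡 2) x →L[ℝ] W) (x : M) (X Y : TangentSpace (𝓡 2) x) : W :=
  extDeriv (fun y => ContinuousAlternatingMap.ofSubsingleton ℝ (Eu 2) W (0 : Fin 1) (inChart α x y))
    (extChartAt (𝓡 2) x x)
    ![mfderiv (𝓡 2) 𝓘(ℝ, Eu 2) (extChartAt (𝓡 2) x) x X,
      mfderiv (𝓡 2) 𝓘(ℝ, Eu 2) (extChartAt (𝓡 2) x) x Y]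

/-- `α` is smooth and `dα = 0`. -/
def IsClosedForm (α : ∀ x : M, TangentSpace (𝓡 2) x →L[ℝ] W) : Prop :=
  IsSmoothForm α ∧ ∀ (x : M) (X Y : TangentSpace (𝓡 2) x), dForm α x X Y = 0

end Forms

/-- `z` is a complex parameter: a smooth local coordinate with `dz ∘ J = i dz`. -/
structure IsComplexParameter (o : ∀ x : M, Orientation ℝ (TangentSpace (𝓡 2) x) (Fin 2))
    (z : OpenPartialHomeomorph M ℂ) : Prop where
  smooth : ContMDiffOn (𝓡 2) 𝓘(ℝ, ℂ) ∞ z z.source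
  smooth_symm : ContMDiffOn 𝓘(ℝ, ℂ) (𝓡 2) ∞ z.symm z.target
  mfderiv_J : ∀ x ∈ z.source, ∀ X : TangentSpace (𝓡 2) x,
    dirDeriv z x (J o x X) = Complex.I * dirDeriv z x X

/-- On the domain of `z` the metric is `μ² dz dz̄`. -/
def IsConformalFactor (z : OpenPartialHomeomorph M ℂ) (μ : M → ℝ) : Prop :=
  ∀ x ∈ z.source, ∀ X Y : TangentSpace (𝓡 2) x,
    inner ℝ X Y = μ x ^ 2 * (dirDeriv z x X * starRingEnd ℂ (dirDeriv z x Y)).re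

/-- The function `f̃` with `α = f̃ dz`, that is `f̃ = α(∂_x)` for `z = x + iy`, on the image of `z`. -/
def coeff {n : ℕ} (α : ∀ x : M, TangentSpace (𝓡 2) x →L[ℝ] Ec n) (z : OpenPartialHomeomorph M ℂ)
    (w : ℂ) : Ec n :=
  α (z.symm w) (mfderiv 𝓘(ℝ, ℂ) (𝓡 2) z.symm w (1 : ℂ))

/-- In each complex parameter `z`, `α = f̃ dz` with `f̃` holomorphic. -/
def IsHolomorphicForm {n : ℕ} (o : ∀ x : M, Orientation ℝ (TangentSpace (𝓡 2) x) (Fin 2))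
    (α : ∀ x : M, TangentSpace (𝓡 2) x →L[ℝ] Ec n) : Prop :=
  ∀ z : OpenPartialHomeomorph M ℂ, IsComplexParameter o z →
    DifferentiableOn ℂ (coeff α z) z.target ∧
    ∀ x ∈ z.source, ∀ X : TangentSpace (𝓡 2) x, α x X = dirDeriv z x X • coeff α z (z x)

end Geometry

instance instRiem {M : Type*} [TopologicalSpace M] [ChartedSpace (Eu 2) M]
    [IsManifold (𝓡 2) ∞ M] [RiemannianBundle (fun x : M => TangentSpace (𝓡 2) x)]
    [IsContMDiffRiemannianBundle (𝓡 2) ∞ (Eu 2) (fun x : M => TangentSpace (𝓡 2) x)] :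
    IsContMDiffRiemannianBundle (𝓡 2) 1 (Eu 2) (fun x : M => TangentSpace (𝓡 2) x) :=
  IsContMDiffRiemannianBundle.of_le (n := ∞) (by norm_cast)

/-- `dz ∧ dz̄ (X, Y)`. -/
def dzdzbar {M : Type*} [TopologicalSpace M] [ChartedSpace (Eu 2) M] (z : M → ℂ) (x : M)
    (X Y : TangentSpace (𝓡 2) x) : ℂ :=
  dirDeriv z x X * starRingEnd ℂ (dirDeriv z x Y) - dirDeriv z x Y * starRingEnd ℂ (dirDeriv z x X)

/-- `F` has differential `α` on `U`. -/
def IsPrimitiveOn {M : Type*} [TopologicalSpace M] [ChartedSpace (Eu 2) M]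
    {W : Type*} [NormedAddCommGroup W] [NormedSpace ℝ W] (F : M → W)
    (α : ∀ x : M, TangentSpace (𝓡 2) x →L[ℝ] W) (U : Set M) : Prop :=
  ∀ x ∈ U, HasMFDerivAt (𝓡 2) 𝓘(ℝ, W) F x (α x)

end SpinSurface

end

/-!
Let `(e₁, e₂)` be a local orthonormal frame of `TM` below a spinorial frame. In that frame
`ξ(e_a) = τ([φ]) e_a [φ]`, and the Killing type equation reads `∂_X[φ] = (η - Ω)[φ]`, where `Ω` is
the connection form and `η = -½ ∑_j e_j · B(X, e_j)`; both are combinations of bivectors, so that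
`τ` changes their signs. Hence `∂_X(ξ(e_a)) = τ([φ]) [e_a, η - Ω] [φ]`. The commutator of a bivector
with a vector is an infinitesimal rotation of that vector: `[Ω, e_a] = ∇_X e_a` and
`[η, e_a] = -B(X, e_a)`. This gives `∂_X(ξ(e_a)) = ξ(∇_X e_a + B(X, e_a))`
(`SpinorField.IsKilling.dirDeriv_xi_frame`).

Now expand `dξ̃(e₁, e₂) = e₁(ξ̃(e₂)) - e₂(ξ̃(e₁)) - ξ̃([e₁, e₂])`. As `∇` has no torsion and
commutes with `J`, the connection terms cancel, and as `B` is symmetric the others add up to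
`i ξ(B(e₁, e₁) + B(e₂, e₂)) = 2i ξ(H)` (`SpinorField.IsKilling.dForm_xiTilde_frame`). In a complex
parameter `μ² dz ∧ dz̄` takes the value `-2i` on `(e₁, e₂)`, which is the formula for `dξ̃`; since `ξ`
is injective on `TM ⊕ E`, it also shows that `ξ̃` is closed exactly when `H = 0`.

A closed form `ξ̃` with `ξ̃ ∘ J = i ξ̃` is `f̃ dz` in a complex parameter, and closedness is the
Cauchy-Riemann equation for `f̃` (`IsComplexParameter.differentiableAt_coeff`). The formula
`F = Re ∫ f̃ dz` is the fundamental theorem of calculus along a path, because `ξ = Re ξ̃`. A closed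
form has local primitives by the Poincaré lemma on balls in charts; on a simply connected surface the
covering by germs of primitives has a section, which is a global primitive `G`
(`exists_primitive_of_local`), and `F - Re G` has zero differential.
-/

noncomputable section

namespace SpinSurface

open scoped Manifold ContDiff Bundle
open Bundle

/-! ### Bivectors in the Clifford algebra -/

theorem vec_mul_add_swap {n : ℕ} (v w : Eu n) :
    vec v * vec w + vec w * vec v = algebraMap ℝ (Cl n) (-(2 * inner ℝ v w)) := by
  rw [CliffordAlgebra.ι_mul_ι_add_swap, QuadraticMap.polar]
  congr 1
  simp only [negSq_apply, norm_add_sq_real]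
  ring

theorem vec_mul_vec_of_inner_eq_zero {n : ℕ} {v w : Eu n} (h : inner ℝ v w = 0) :
    vec w * vec v = -(vec v * vec w) := by
  rw [eq_neg_iff_add_eq_zero, add_comm, vec_mul_add_swap, h]
  simp

/-- The commutator of `u · v` with a vector is the vector obtained by the infinitesimal
rotation that the bivector of `u` and `v` generates. -/
theorem commutator_vec_mul_vec {n : ℕ} (u v w : Eu n) :
    vec u * vec v * vec w - vec w * (vec u * vec v) =
      (2 * inner ℝ u w) • vec v - (2 * inner ℝ v w) • vec u := by
  have h1 := vec_mul_add_swap v w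
  have h2 := vec_mul_add_swap u w
  have e : vec u * vec v * vec w - vec w * (vec u * vec v) =
      vec u * (vec v * vec w + vec w * vec v) - (vec u * vec w + vec w * vec u) * vec v := by
    noncomm_ring
  rw [e, h1, h2, ← Algebra.commutes, ← Algebra.smul_def, ← Algebra.smul_def]
  module

theorem tau_vec_mul_vec {n : ℕ} {u v : Eu n} (h : inner ℝ u v = 0) :
    tau (vec u * vec v) = -(vec u * vec v) := by
  rw [CliffordAlgebra.reverse.map_mul, CliffordAlgebra.reverse_ι, CliffordAlgebra.reverse_ι]
  exact vec_mul_vec_of_inner_eq_zero h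

/-- The bivector `½ ∑_{a<b} c a b • f_a f_b`. -/
def bivector {n k : ℕ} (f : Fin k → Eu n) (c : Fin k → Fin k → ℝ) : Cl n :=
  (1 / 2 : ℝ) • ∑ a, ∑ b ∈ Finset.Ioi a, c a b • (vec (f a) * vec (f b))

theorem commutator_bivector {n k : ℕ} (f : Fin k → Eu n) (c : Fin k → Fin k → ℝ)
    (hc : ∀ a b, c a b = -c b a) (w : Eu n) :
    bivector f c * vec w - vec w * bivector f c =
      ∑ a, ∑ b, (c a b * inner ℝ (f a) w) • vec (f b) := by
  have h0 : ∀ a, c a a = 0 := fun a => by have := hc a a; linarith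
  -- the sum over all pairs is the sum over `a < b` of the terms of `(a, b)` and `(b, a)`
  have key : ∀ F : Fin k → Fin k → Cl n, (∀ a, F a a = 0) →
      ∑ a, ∑ b, F a b = ∑ a, ∑ b ∈ Finset.Ioi a, (F a b + F b a) := by
    intro F hF
    have h1 : ∀ a, ∑ b, F a b = ∑ b ∈ Finset.Ioi a, F a b + ∑ b ∈ Finset.Iio a, F a b := by
      intro a
      have hd : Disjoint (Finset.Ioi a) (Finset.Iio a) := by
        rw [Finset.disjoint_left]
        intro b hb hb'
        exact absurd (Finset.mem_Ioi.1 hb) (not_lt.2 (Finset.mem_Iio.1 hb').le)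
      rw [← Finset.sum_union hd, ← Finset.sum_erase Finset.univ (hF a)]
      refine Finset.sum_congr ?_ fun _ _ => rfl
      ext b
      simp only [Finset.mem_erase, Finset.mem_univ, and_true, Finset.mem_union, Finset.mem_Ioi,
        Finset.mem_Iio]
      rw [ne_iff_lt_or_gt, or_comm]
    simp only [h1, Finset.sum_add_distrib]
    congr 1
    refine Finset.sum_comm' fun a b => ?_
    simp
  rw [key _ fun a => by rw [h0, zero_mul, zero_smul], bivector, smul_mul_assoc, mul_smul_comm,
    ← smul_sub, Finset.sum_mul, Finset.mul_sum, ← Finset.sum_sub_distrib, Finset.smul_sum]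
  refine Finset.sum_congr rfl fun a _ => ?_
  rw [Finset.sum_mul, Finset.mul_sum, ← Finset.sum_sub_distrib, Finset.smul_sum]
  refine Finset.sum_congr rfl fun b _ => ?_
  rw [smul_mul_assoc, mul_smul_comm, ← smul_sub, commutator_vec_mul_vec, hc b a]
  module

theorem tau_bivector {n k : ℕ} (f : Fin k → Eu n) (c : Fin k → Fin k → ℝ)
    (hf : ∀ a b, a ≠ b → inner ℝ (f a) (f b) = 0) :
    tau (bivector f c) = -bivector f c := by
  simp only [bivector, map_smul, map_sum, ← smul_neg, ← Finset.sum_neg_distrib]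
  refine congrArg _ (Finset.sum_congr rfl fun a _ => Finset.sum_congr rfl fun b hb => ?_)
  rw [tau_vec_mul_vec (hf a b (Finset.mem_Ioi.1 hb).ne)]

theorem inner_inclL_inclL {p q : ℕ} (v w : Eu p) :
    inner ℝ (inclL p q v) (inclL p q w) = inner ℝ v w := by
  simp [PiLp.inner_apply, Fin.sum_univ_add, inclL]

theorem inner_inclR_inclR {p q : ℕ} (v w : Eu q) :
    inner ℝ (inclR p q v) (inclR p q w) = inner ℝ v w := by
  simp [PiLp.inner_apply, Fin.sum_univ_add, inclR]

theorem inner_inclL_inclR {p q : ℕ} (v : Eu p) (w : Eu q) :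
    inner ℝ (inclL p q v) (inclR p q w) = 0 := by
  simp [PiLp.inner_apply, Fin.sum_univ_add, inclR, inclL]

theorem inner_inclR_inclL {p q : ℕ} (v : Eu p) (w : Eu q) :
    inner ℝ (inclR p q w) (inclL p q v) = 0 := by
  rw [real_inner_comm, inner_inclL_inclR]

theorem eq_zero_of_inclL_add_inclR_eq_zero {p q : ℕ} {v : Eu p} {w : Eu q}
    (h : inclL p q v + inclR p q w = 0) : v = 0 ∧ w = 0 := by
  constructor
  · ext i
    simpa [inclL, inclR] using congrArg (fun z : Eu (p + q) => z (Fin.castAdd q i)) h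
  · ext i
    simpa [inclL, inclR] using congrArg (fun z : Eu (p + q) => z (Fin.natAdd p i)) h

/-- The sum of the bivectors of an antisymmetric `c` on `ℝᵖ` and `d` on `ℝ^q` acts on `ℝᵖ` by
`c`. -/
theorem commutator_spinConnection {p q : ℕ} (c : Fin p → Fin p → ℝ) (d : Fin q → Fin q → ℝ)
    (hc : ∀ a b, c a b = -c b a) (hd : ∀ a b, d a b = -d b a) (a : Fin p) (v : Eu p)
    (hv : ∀ b, v b = c a b) :
    (bivector (fun i => inclL p q (EuclideanSpace.single i 1)) c +
        bivector (fun i => inclR p q (EuclideanSpace.single i 1)) d) *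
        vec (inclL p q (EuclideanSpace.single a 1)) -
      vec (inclL p q (EuclideanSpace.single a 1)) *
        (bivector (fun i => inclL p q (EuclideanSpace.single i 1)) c +
        bivector (fun i => inclR p q (EuclideanSpace.single i 1)) d) = vec (inclL p q v) := by
  have e : ∀ x y z : Cl (p + q), (x + y) * z - z * (x + y) = (x * z - z * x) + (y * z - z * y) :=
    fun x y z => by noncomm_ring
  rw [e, commutator_bivector _ _ hc, commutator_bivector _ _ hd]
  simp only [inner_inclR_inclL, mul_zero, zero_smul, Finset.sum_const_zero, add_zero,
    inner_inclL_inclL]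
  have hsum : v = ∑ b, c a b • (EuclideanSpace.single b 1 : Eu p) := by
    ext b
    simp [hv, Pi.single_apply]
  rw [Finset.sum_eq_single a]
  · conv_rhs => rw [hsum]
    simp
  · intro b _ hb
    simp [EuclideanSpace.inner_single_left, hb.symm]
  · simp

/-- The operator `-½ ∑_j e_j · b_j` of the Killing equation, for `b_j` in the second factor. -/
def killingElt {p q : ℕ} (b : Fin p → Eu q) : Cl (p + q) :=
  -(1 / 2 : ℝ) • ∑ j, vec (inclL p q (EuclideanSpace.single j 1)) * vec (inclR p q (b j))

theorem commutator_killingElt {p q : ℕ} (b : Fin p → Eu q) (a : Fin p) :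
    killingElt b * vec (inclL p q (EuclideanSpace.single a 1)) -
      vec (inclL p q (EuclideanSpace.single a 1)) * killingElt b = -vec (inclR p q (b a)) := by
  rw [killingElt, smul_mul_assoc, mul_smul_comm, ← smul_sub, Finset.sum_mul, Finset.mul_sum,
    ← Finset.sum_sub_distrib]
  simp only [commutator_vec_mul_vec, inner_inclR_inclL, inner_inclL_inclL]
  rw [Finset.sum_eq_single a]
  · simp only [mul_zero, zero_smul, sub_zero]
    simp
  · intro c _ hc
    simp [EuclideanSpace.inner_single_left, hc.symm]
  · simp

theorem tau_killingElt {p q : ℕ} (b : Fin p → Eu q) : tau (killingElt b) = -killingElt b := by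
  simp only [killingElt, map_smul, map_sum, ← smul_neg, ← Finset.sum_neg_distrib]
  refine congrArg _ (Finset.sum_congr rfl fun a _ => ?_)
  rw [tau_vec_mul_vec (inner_inclL_inclR _ _)]

/-! ### The exterior derivative and pullbacks -/

section Forms

variable {M : Type*} [TopologicalSpace M] [ChartedSpace (Eu 2) M]
  {W : Type*} [NormedAddCommGroup W] [NormedSpace ℝ W]

/-- `dα(X, Y)` is the antisymmetrized derivative of the expression of `α` in a chart. -/
theorem dForm_eq_fderiv {α : ∀ x : M, TangentSpace (𝓡 2) x →L[ℝ] W} {x : M}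
    (hα : DifferentiableAt ℝ (inChart α x) (extChartAt (𝓡 2) x x)) (X Y : TangentSpace (𝓡 2) x) :
    dForm α x X Y =
      fderiv ℝ (inChart α x) (extChartAt (𝓡 2) x x)
        (mfderiv (𝓡 2) 𝓘(ℝ, Eu 2) (extChartAt (𝓡 2) x) x X)
        (mfderiv (𝓡 2) 𝓘(ℝ, Eu 2) (extChartAt (𝓡 2) x) x Y) -
      fderiv ℝ (inChart α x) (extChartAt (𝓡 2) x x)
        (mfderiv (𝓡 2) 𝓘(ℝ, Eu 2) (extChartAt (𝓡 2) x) x Y)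
        (mfderiv (𝓡 2) 𝓘(ℝ, Eu 2) (extChartAt (𝓡 2) x) x X) := by
  let L : (Eu 2 →L[ℝ] W) →L[ℝ] (Eu 2 [⋀^Fin 1]→L[ℝ] W) :=
    (ContinuousAlternatingMap.ofSubsingletonLIE (𝕜 := ℝ) (E := Eu 2) (F := W)
      (0 : Fin 1)).toContinuousLinearEquiv.toContinuousLinearMap
  have hL : HasFDerivAt (fun y => L (inChart α x y))
      (L.comp (fderiv ℝ (inChart α x) (extChartAt (𝓡 2) x x))) (extChartAt (𝓡 2) x x) :=
    L.hasFDerivAt.comp (extChartAt (𝓡 2) x x) hα.hasFDerivAt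
  have h2 := hL.fderiv
  unfold dForm extDeriv
  rw [ContinuousAlternatingMap.alternatizeUncurryFin_apply]
  erw [h2]
  simp [Fin.sum_univ_two, sub_eq_add_neg]
  rfl

variable [IsManifold (𝓡 2) ∞ M]

theorem mfderiv_extChartAt_comp_mfderiv_symm {x : M} {y : Eu 2}
    (hy : y ∈ (extChartAt (𝓡 2) x).target) (v : Eu 2) :
    mfderiv (𝓡 2) 𝓘(ℝ, Eu 2) (extChartAt (𝓡 2) x) ((extChartAt (𝓡 2) x).symm y)
      (mfderiv 𝓘(ℝ, Eu 2) (𝓡 2) (extChartAt (𝓡 2) x).symm y v) = v := by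
  have h := mfderiv_extChartAt_comp_mfderivWithin_extChartAt_symm (I := 𝓡 2) hy
  rw [ModelWithCorners.Boundaryless.range_eq_univ, mfderivWithin_univ] at h
  exact congrArg (fun L : Eu 2 →L[ℝ] Eu 2 => L v) h

theorem mfderiv_symm_comp_mfderiv_extChartAt {x y : M}
    (hy : y ∈ (extChartAt (𝓡 2) x).source) (v : TangentSpace (𝓡 2) y) :
    mfderiv 𝓘(ℝ, Eu 2) (𝓡 2) (extChartAt (𝓡 2) x).symm (extChartAt (𝓡 2) x y)
      (mfderiv (𝓡 2) 𝓘(ℝ, Eu 2) (extChartAt (𝓡 2) x) y v) = v := by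
  have h := mfderivWithin_extChartAt_symm_comp_mfderiv_extChartAt' (I := 𝓡 2) hy
  rw [ModelWithCorners.Boundaryless.range_eq_univ, mfderivWithin_univ] at h
  exact congrArg (fun L : Eu 2 →L[ℝ] Eu 2 => L v) h

/-- A form is the pullback by a chart of its expression in that chart. -/
theorem inChart_mfderiv_extChartAt (α : ∀ x : M, TangentSpace (𝓡 2) x →L[ℝ] W) {x y : M}
    (hy : y ∈ (extChartAt (𝓡 2) x).source) (v : TangentSpace (𝓡 2) y) :
    inChart α x (extChartAt (𝓡 2) x y) (mfderiv (𝓡 2) 𝓘(ℝ, Eu 2) (extChartAt (𝓡 2) x) y v) =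
      α y v := by
  have h := mfderiv_symm_comp_mfderiv_extChartAt hy v
  have h' := (extChartAt (𝓡 2) x).left_inv hy
  calc _ = α ((extChartAt (𝓡 2) x).symm (extChartAt (𝓡 2) x y)) v := congrArg _ h
    _ = _ := congrArg (fun z : M => α z (show TangentSpace (𝓡 2) z from v)) h'

theorem isInvertible_mfderiv_extChartAt_symm {x : M} {y : Eu 2}
    (hy : y ∈ (extChartAt (𝓡 2) x).target) :
    (mfderiv 𝓘(ℝ, Eu 2) (𝓡 2) (extChartAt (𝓡 2) x).symm y).IsInvertible := by
  have h := isInvertible_mfderivWithin_extChartAt_symm (I := 𝓡 2) hy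
  rwa [ModelWithCorners.Boundaryless.range_eq_univ, mfderivWithin_univ] at h

/-- The exterior derivative commutes with pullback by a smooth map `ψ` from a normed space. -/
theorem dForm_pullback {V : Type*} [NormedAddCommGroup V] [NormedSpace ℝ V]
    {α : ∀ x : M, TangentSpace (𝓡 2) x →L[ℝ] W} {ψ : V → M} {w : V}
    (hψ : ContMDiffAt 𝓘(ℝ, V) (𝓡 2) 2 ψ w)
    (hα : DifferentiableAt ℝ (inChart α (ψ w)) (extChartAt (𝓡 2) (ψ w) (ψ w)))
    {β : V → V →L[ℝ] W}
    (hβ : ∀ᶠ y in nhds w, ∀ v, β y v = α (ψ y) (mfderiv 𝓘(ℝ, V) (𝓡 2) ψ y v)) :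
    DifferentiableAt ℝ β w ∧ ∀ u v, fderiv ℝ β w u v - fderiv ℝ β w v u =
      dForm α (ψ w) (mfderiv 𝓘(ℝ, V) (𝓡 2) ψ w u) (mfderiv 𝓘(ℝ, V) (𝓡 2) ψ w v) := by
  set φ := extChartAt (𝓡 2) (ψ w) with hφ
  set f : V → Eu 2 := fun y => φ (ψ y) with hf
  have hfC : ContDiffAt ℝ 2 f w := by
    rw [← contMDiffAt_iff_contDiffAt]
    exact ContMDiffAt.comp w (contMDiffAt_extChartAt (n := 2)) hψ
  have hev : ∀ᶠ y in nhds w, MDifferentiableAt 𝓘(ℝ, V) (𝓡 2) ψ y ∧ ψ y ∈ φ.source := by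
    refine (((contMDiffAt_iff_contMDiffAt_nhds (by decide)).1 hψ).mono
      fun y h => h.mdifferentiableAt (by decide)).and ?_
    exact hψ.continuousAt.eventually (extChartAt_source_mem_nhds (I := 𝓡 2) (ψ w))
  have hfd : ∀ᶠ y in nhds w, ∀ v, fderiv ℝ f y v =
      mfderiv (𝓡 2) 𝓘(ℝ, Eu 2) φ (ψ y) (mfderiv 𝓘(ℝ, V) (𝓡 2) ψ y v) := by
    filter_upwards [hev] with y hy v
    have h1 : MDifferentiableAt (𝓡 2) 𝓘(ℝ, Eu 2) φ (ψ y) :=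
      mdifferentiableAt_extChartAt (by simpa [hφ] using hy.2)
    have h2 := mfderiv_comp y h1 hy.1
    rw [← mfderiv_eq_fderiv]
    exact congrArg (fun L : V →L[ℝ] Eu 2 => L v) h2
  have hβ' : β =ᶠ[nhds w] fun y => (inChart α (ψ w) (f y)).comp (fderiv ℝ f y) := by
    filter_upwards [hev, hfd, hβ] with y hy hd hb
    ext v
    rw [ContinuousLinearMap.comp_apply, hd, hb]
    exact (inChart_mfderiv_extChartAt α hy.2 _).symm
  have hd1 : HasFDerivAt (fun y => inChart α (ψ w) (f y))
      ((fderiv ℝ (inChart α (ψ w)) (f w)).comp (fderiv ℝ f w)) w :=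
    HasFDerivAt.comp (g := inChart α (ψ w)) w
      (DifferentiableAt.hasFDerivAt (x := f w) hα) (hfC.differentiableAt (by decide)).hasFDerivAt
  have hd2 : HasFDerivAt (fderiv ℝ f) (fderiv ℝ (fderiv ℝ f) w) w :=
    ((hfC.fderiv_right (m := 1) (by norm_num)).differentiableAt (by decide)).hasFDerivAt
  have hd3 := (hd1.clm_comp hd2).congr_of_eventuallyEq hβ'
  refine ⟨hd3.differentiableAt, fun u v => ?_⟩
  have hs : fderiv ℝ (fderiv ℝ f) w u v = fderiv ℝ (fderiv ℝ f) w v u :=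
    (hfC.isSymmSndFDerivAt (by simp)).eq u v
  rw [hd3.fderiv, dForm_eq_fderiv hα, ← hφ, ← hfd.self_of_nhds u, ← hfd.self_of_nhds v]
  simp [hs]
  rfl

end Forms

/-! ### Forms and vector fields -/

section VectorFields

variable {M : Type*} [TopologicalSpace M] [ChartedSpace (Eu 2) M] [IsManifold (𝓡 2) ∞ M]
  {W : Type*} [NormedAddCommGroup W] [NormedSpace ℝ W]

theorem inChart_inverse_mfderiv_symm (α : ∀ x : M, TangentSpace (𝓡 2) x →L[ℝ] W)
    (V : ∀ x : M, TangentSpace (𝓡 2) x) {x : M} {y : Eu 2}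
    (hy : y ∈ (extChartAt (𝓡 2) x).target) :
    inChart α x y ((mfderiv 𝓘(ℝ, Eu 2) (𝓡 2) (extChartAt (𝓡 2) x).symm y).inverse
      (V ((extChartAt (𝓡 2) x).symm y))) =
      α ((extChartAt (𝓡 2) x).symm y) (V ((extChartAt (𝓡 2) x).symm y)) :=
  congrArg (α ((extChartAt (𝓡 2) x).symm y))
    ((isInvertible_mfderiv_extChartAt_symm hy).self_apply_inverse _)

/-- The invariant formula `dα(V, W) = V(α(W)) - W(α(V)) - α([V, W])`. -/
theorem dForm_apply_vectorField {α : ∀ x : M, TangentSpace (𝓡 2) x →L[ℝ] W} {x : M}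
    (hα : DifferentiableAt ℝ (inChart α x) (extChartAt (𝓡 2) x x))
    {V₁ V₂ : ∀ x : M, TangentSpace (𝓡 2) x}
    (h₁ : ContMDiffAt (𝓡 2) ((𝓡 2).prod 𝓘(ℝ, Eu 2)) 1
      (fun x => TotalSpace.mk' (Eu 2) x (V₁ x)) x)
    (h₂ : ContMDiffAt (𝓡 2) ((𝓡 2).prod 𝓘(ℝ, Eu 2)) 1
      (fun x => TotalSpace.mk' (Eu 2) x (V₂ x)) x) :
    dForm α x (V₁ x) (V₂ x) =
      dirDeriv (fun y => α y (V₂ y)) x (V₁ x) - dirDeriv (fun y => α y (V₁ y)) x (V₂ x) -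
        α x (VectorField.mlieBracket (𝓡 2) V₁ V₂ x) := by
  set φ := extChartAt (𝓡 2) x with hφ
  have hx : x ∈ φ.source := mem_extChartAt_source x
  have hxt : φ x ∈ φ.target := mem_extChartAt_target x
  have hnt : φ.target ∈ nhds (φ x) := extChartAt_target_mem_nhds x
  -- the expressions of the vector fields in the chart
  let P : (∀ x : M, TangentSpace (𝓡 2) x) → Eu 2 → Eu 2 := fun V y =>
    (mfderiv 𝓘(ℝ, Eu 2) (𝓡 2) φ.symm y).inverse (V (φ.symm y))
  have hPd : ∀ V : (∀ x : M, TangentSpace (𝓡 2) x),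
      ContMDiffAt (𝓡 2) ((𝓡 2).prod 𝓘(ℝ, Eu 2)) 1
      (fun x => TotalSpace.mk' (Eu 2) x (V x)) x → DifferentiableAt ℝ (P V) (φ x) := by
    intro V hV
    have h := VectorField.contMDiffWithinAt_mpullbackWithin_extChartAt_symm (n := 2) (m := 1)
      (s := Set.univ) (V := V) (x := x) (I := 𝓡 2) hV.contMDiffWithinAt uniqueMDiffOn_univ
      (Set.mem_univ _) (by norm_num)
    rw [Set.preimage_univ, Set.inter_univ] at h
    have h' := h.contMDiffAt hnt
    rw [ModelWithCorners.Boundaryless.range_eq_univ, VectorField.mpullbackWithin_univ] at h'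
    exact (contMDiffAt_vectorSpace_iff_contDiffAt.1 h').differentiableAt (by decide)
  have hP : ∀ V : (∀ x : M, TangentSpace (𝓡 2) x),
      P V (φ x) = mfderiv (𝓡 2) 𝓘(ℝ, Eu 2) φ x (V x) := by
    intro V
    have e : (V (φ.symm (φ x)) : Eu 2) = V x :=
      congrArg (fun z : M => (V z : Eu 2)) (φ.left_inv hx)
    have hi := isInvertible_mfderiv_extChartAt_symm hxt
    have e' : (mfderiv 𝓘(ℝ, Eu 2) (𝓡 2) φ.symm (φ x))
        (mfderiv (𝓡 2) 𝓘(ℝ, Eu 2) φ x (V x)) = V (φ.symm (φ x)) :=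
      (mfderiv_symm_comp_mfderiv_extChartAt hx (V x)).trans e.symm
    change (mfderiv 𝓘(ℝ, Eu 2) (𝓡 2) φ.symm (φ x)).inverse (V (φ.symm (φ x))) = _
    rw [← e']
    exact hi.inverse_apply_self _
  -- the product rule for `α(V)` in the chart
  have hD : ∀ V : (∀ x : M, TangentSpace (𝓡 2) x), DifferentiableAt ℝ (P V) (φ x) →
      ∀ X : TangentSpace (𝓡 2) x, dirDeriv (fun y => α y (V y)) x X =
        fderiv ℝ (inChart α x) (φ x) (mfderiv (𝓡 2) 𝓘(ℝ, Eu 2) φ x X) (P V (φ x)) +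
        inChart α x (φ x) (fderiv ℝ (P V) (φ x) (mfderiv (𝓡 2) 𝓘(ℝ, Eu 2) φ x X)) := by
    intro V hV X
    have h1 := hα.hasFDerivAt.clm_apply hV.hasFDerivAt
    have h2 : (fun y => α y (V y)) =ᶠ[nhds x] (fun y => inChart α x y (P V y)) ∘ φ := by
      filter_upwards [extChartAt_source_mem_nhds (I := 𝓡 2) x] with y hy
      have := inChart_inverse_mfderiv_symm α V (φ.map_source hy)
      exact (this.trans (congrArg (fun z => α z (V z)) (φ.left_inv hy))).symm
    have h3 : HasMFDerivAt (𝓡 2) 𝓘(ℝ, Eu 2) φ x (mfderiv (𝓡 2) 𝓘(ℝ, Eu 2) φ x) :=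
      (mdifferentiableAt_extChartAt (mem_chart_source _ x)).hasMFDerivAt
    have h4 := (HasMFDerivAt.comp x h1.hasMFDerivAt h3).congr_of_eventuallyEq h2
    rw [dirDeriv, h4.mfderiv]
    exact add_comm _ _
  have hbr : α x (VectorField.mlieBracket (𝓡 2) V₁ V₂ x) =
      inChart α x (φ x) (fderiv ℝ (P V₂) (φ x) (P V₁ (φ x)) -
        fderiv ℝ (P V₁) (φ x) (P V₂ (φ x))) := by
    rw [← inChart_mfderiv_extChartAt α hx]
    congr 1
    rw [← VectorField.mlieBracketWithin_univ, VectorField.mlieBracketWithin_apply]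
    have hi : (mfderiv (𝓡 2) 𝓘(ℝ, Eu 2) φ x).IsInvertible := isInvertible_mfderiv_extChartAt hx
    refine (hi.self_apply_inverse _).trans ?_
    have hpw : ∀ V : (∀ x : M, TangentSpace (𝓡 2) x),
        VectorField.mpullbackWithin 𝓘(ℝ, Eu 2) (𝓡 2) φ.symm V Set.univ = P V := fun V =>
      VectorField.mpullbackWithin_univ
    rw [ModelWithCorners.Boundaryless.range_eq_univ, Set.preimage_univ, Set.inter_univ]
    have e := congrFun (VectorField.lieBracketWithin_univ (𝕜 := ℝ) (V := P V₁) (W := P V₂)) (φ x)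
    rw [← hpw, ← hpw] at e
    refine Eq.trans e ?_
    rw [hpw, hpw]
    rfl
  rw [dForm_eq_fderiv hα, hD _ (hPd _ h₁), hD _ (hPd _ h₂), hbr, ← hφ, ← hP, ← hP, map_sub]
  abel

/-- A form is smooth as soon as its values on smooth vector fields are smooth functions. -/
theorem isSmoothForm_of_apply_vectorField {α : ∀ x : M, TangentSpace (𝓡 2) x →L[ℝ] W}
    (h : ∀ (V : ∀ x : M, TangentSpace (𝓡 2) x) (x : M),
      ContMDiffAt (𝓡 2) ((𝓡 2).prod 𝓘(ℝ, Eu 2)) ∞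
        (fun x => TotalSpace.mk' (Eu 2) x (V x)) x →
      ContMDiffAt (𝓡 2) 𝓘(ℝ, W) ∞ (fun y => α y (V y)) x) :
    IsSmoothForm α := by
  intro x
  rw [contDiffOn_clm_apply]
  intro v y hy
  set φ := extChartAt (𝓡 2) x with hφ
  -- the vector field which is the constant `v` in the chart
  let V : ∀ x : M, TangentSpace (𝓡 2) x :=
    VectorField.mpullback (𝓡 2) 𝓘(ℝ, Eu 2) φ (fun _ => v)
  have hys := φ.map_target hy
  have hV : ContMDiffAt (𝓡 2) ((𝓡 2).prod 𝓘(ℝ, Eu 2)) ∞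
        (fun x => TotalSpace.mk' (Eu 2) x (V x)) (φ.symm y) :=
    ContMDiffAt.mpullback_vectorField_preimage (n := ∞)
      (contMDiffAt_vectorSpace_iff_contDiffAt.2 contDiffAt_const)
      (contMDiffAt_extChartAt' (by simpa [hφ] using hys)) (isInvertible_mfderiv_extChartAt hys)
      (by norm_cast)
  have h1 := (h V _ hV).comp y
    ((contMDiffOn_extChartAt_symm x).contMDiffAt (extChartAt_target_mem_nhds' hy))
  rw [contMDiffAt_iff_contDiffAt] at h1
  refine (h1.congr_of_eventuallyEq ?_).contDiffWithinAt
  filter_upwards [extChartAt_target_mem_nhds' hy] with z hz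
  change α _ _ = α _ _
  congr 1
  have hi : (mfderiv (𝓡 2) 𝓘(ℝ, Eu 2) φ (φ.symm z)).IsInvertible :=
    isInvertible_mfderiv_extChartAt (φ.map_target hz)
  have e := mfderiv_extChartAt_comp_mfderiv_symm hz v
  change _ = (mfderiv (𝓡 2) 𝓘(ℝ, Eu 2) φ (φ.symm z)).inverse v
  conv_rhs => rw [← e]
  exact (hi.inverse_apply_self _).symm

end VectorFields

/-! ### Primitives of closed forms -/

section Primitives

variable {M : Type*} [TopologicalSpace M] [ChartedSpace (Eu 2) M] [IsManifold (𝓡 2) ∞ M]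
  {W : Type*} [NormedAddCommGroup W] [NormedSpace ℝ W]

omit [IsManifold (𝓡 2) ∞ M] in
theorem exists_ball_extChartAt_subset (x : M) {U : Set M} (hU : U ∈ nhds x) :
    ∃ r > 0, Metric.ball (extChartAt (𝓡 2) x x) r ⊆ (extChartAt (𝓡 2) x).target ∧
      ∀ y ∈ Metric.ball (extChartAt (𝓡 2) x x) r, (extChartAt (𝓡 2) x).symm y ∈ U := by
  have h1 : (extChartAt (𝓡 2) x).target ∩ (extChartAt (𝓡 2) x).symm ⁻¹' U ∈
      nhds (extChartAt (𝓡 2) x x) := by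
    refine Filter.inter_mem (extChartAt_target_mem_nhds x) ?_
    refine (continuousAt_extChartAt_symm x).preimage_mem_nhds ?_
    rwa [extChartAt_to_inv]
  obtain ⟨r, hr, h⟩ := Metric.mem_nhds_iff.1 h1
  exact ⟨r, hr, fun y hy => (h hy).1, fun y hy => (h hy).2⟩

omit [IsManifold (𝓡 2) ∞ M] in
theorem preimage_extChartAt_ball_mem_nhds (x : M) {r : ℝ} (hr : 0 < r) :
    (extChartAt (𝓡 2) x).source ∩ extChartAt (𝓡 2) x ⁻¹'
      Metric.ball (extChartAt (𝓡 2) x x) r ∈ nhds x :=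
  Filter.inter_mem (extChartAt_source_mem_nhds x)
    ((continuousAt_extChartAt x).preimage_mem_nhds (Metric.ball_mem_nhds _ hr))

theorem eventually_eq_of_hasMFDerivAt_zero {D : M → W} {x : M}
    (hD : ∀ᶠ y in nhds x,
      HasMFDerivAt (𝓡 2) 𝓘(ℝ, W) D y (0 : TangentSpace (𝓡 2) y →L[ℝ] W)) :
    ∀ᶠ y in nhds x, D y = D x := by
  set φ := extChartAt (𝓡 2) x with hφ
  obtain ⟨r, hr, h1, h2⟩ := exists_ball_extChartAt_subset x hD
  have hd : ∀ y ∈ Metric.ball (φ x) r,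
      HasFDerivWithinAt (D ∘ φ.symm) (0 : Eu 2 →L[ℝ] W) (Metric.ball (φ x) r) y := by
    intro y hy
    have h3 : HasMFDerivAt 𝓘(ℝ, Eu 2) (𝓡 2) φ.symm y (mfderiv 𝓘(ℝ, Eu 2) (𝓡 2) φ.symm y) :=
      (((contMDiffOn_extChartAt_symm (n := ∞) x).contMDiffAt
        (extChartAt_target_mem_nhds' (h1 hy))).mdifferentiableAt (by decide)).hasMFDerivAt
    have h4 := HasMFDerivAt.comp y (h2 y hy) h3
    exact (hasMFDerivAt_iff_hasFDerivAt.1 h4).hasFDerivWithinAt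
  filter_upwards [preimage_extChartAt_ball_mem_nhds x hr] with y hy
  have h5 := (convex_ball (φ x) r).is_const_of_fderivWithin_eq_zero (𝕜 := ℝ)
    (fun z hz => (hd z hz).differentiableWithinAt)
    (fun z hz => (hd z hz).fderivWithin (Metric.isOpen_ball.uniqueDiffWithinAt hz))
    hy.2 (Metric.mem_ball_self hr)
  rwa [Function.comp_apply, Function.comp_apply, φ.left_inv hy.1,
    φ.left_inv (mem_extChartAt_source x)] at h5

/-- A map with zero differential on a connected surface is constant. -/
theorem eq_const_of_hasMFDerivAt_zero [PreconnectedSpace M] {D : M → W}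
    (hD : ∀ y, HasMFDerivAt (𝓡 2) 𝓘(ℝ, W) D y (0 : TangentSpace (𝓡 2) y →L[ℝ] W)) (x y : M) :
    D x = D y := by
  have h : IsLocallyConstant D := (IsLocallyConstant.iff_eventually_eq D).2 fun x =>
    eventually_eq_of_hasMFDerivAt_zero (Filter.Eventually.of_forall hD)
  exact h.apply_eq_of_isPreconnected isPreconnected_univ (Set.mem_univ _) (Set.mem_univ _)

/-- A closed form has local primitives, by the Poincaré lemma on a ball in a chart. -/
theorem IsClosedForm.exists_local_primitive [CompleteSpace W]
    {α : ∀ x : M, TangentSpace (𝓡 2) x →L[ℝ] W} (hα : IsClosedForm α) (x : M) :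
    ∃ (U : Set M) (g : M → W), IsOpen U ∧ x ∈ U ∧ IsPrimitiveOn g α U := by
  set φ := extChartAt (𝓡 2) x with hφ
  obtain ⟨r, hr, h1, -⟩ := exists_ball_extChartAt_subset x Filter.univ_mem
  have hd : ∀ y ∈ Metric.ball (φ x) r, DifferentiableAt ℝ (inChart α x) y ∧ ∀ u v,
      fderiv ℝ (inChart α x) y u v = fderiv ℝ (inChart α x) y v u := by
    intro y hy
    have h3 : ContMDiffAt 𝓘(ℝ, Eu 2) (𝓡 2) 2 φ.symm y :=
      (contMDiffOn_extChartAt_symm (n := 2) x).contMDiffAt (extChartAt_target_mem_nhds' (h1 hy))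
    have h4 : DifferentiableAt ℝ (inChart α (φ.symm y))
        (extChartAt (𝓡 2) (φ.symm y) (φ.symm y)) :=
      ((hα.1 _).contDiffAt (extChartAt_target_mem_nhds _)).differentiableAt (by decide)
    obtain ⟨h5, h6⟩ := dForm_pullback (β := inChart α x) h3 h4
      (Filter.Eventually.of_forall fun y v => rfl)
    refine ⟨h5, fun u v => ?_⟩
    rw [← sub_eq_zero, h6]
    exact hα.2 _ _ _
  obtain ⟨f, hf⟩ := (convex_ball (φ x) r).exists_forall_hasFDerivAt_of_fderiv_symmetric
    Metric.isOpen_ball (fun y hy => (hd y hy).1.differentiableWithinAt) fun y hy => (hd y hy).2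
  refine ⟨φ.source ∩ φ ⁻¹' Metric.ball (φ x) r, f ∘ φ,
    isOpen_extChartAt_preimage' x Metric.isOpen_ball,
    ⟨mem_extChartAt_source x, Metric.mem_ball_self hr⟩, fun y hy => ?_⟩
  have h3 : HasMFDerivAt (𝓡 2) 𝓘(ℝ, Eu 2) φ y (mfderiv (𝓡 2) 𝓘(ℝ, Eu 2) φ y) :=
    (mdifferentiableAt_extChartAt (by simpa [hφ] using hy.1)).hasMFDerivAt
  have h4 := HasMFDerivAt.comp y (hf _ hy.2).hasMFDerivAt h3
  exact h4.congr_mfderiv (ContinuousLinearMap.ext fun v => inChart_mfderiv_extChartAt α hy.1 v)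

/-- The space `W` with the discrete topology. -/
def DiscreteCopy (W : Type*) : Type _ := W

/-- The underlying element of `W`. -/
def DiscreteCopy.val {W : Type*} (c : DiscreteCopy W) : W := c

instance (W : Type*) : TopologicalSpace (DiscreteCopy W) := ⊥

instance (W : Type*) : DiscreteTopology (DiscreteCopy W) := ⟨rfl⟩

/-- The covering space of germs of primitives of a form with local primitives `g i` on `U i`. The
germ of `g i + c` has the coordinate `c` in the chart `i`. -/
def primitiveCover (U : M → Set M) (g : M → M → W) (hU : ∀ i, IsOpen (U i)) (hx : ∀ x, x ∈ U x)
    (hg : ∀ i j, ∀ x ∈ U i ∩ U j, ∀ᶠ y in nhds x, g i y - g j y = g i x - g j x) :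
    FiberBundleCore M M (DiscreteCopy W) where
  baseSet := U
  isOpen_baseSet := hU
  indexAt := id
  mem_baseSet_at := hx
  coordChange i j x c := (c.val + (g i x - g j x) : W)
  coordChange_self i x _ c := by rw [sub_self, add_zero]; rfl
  coordChange_comp i j k x _ c := by
    change c.val + (g i x - g j x) + (g j x - g k x) = c.val + (g i x - g k x)
    abel
  continuousOn_coordChange i j := by
    rintro ⟨x, c⟩ hxc
    refine ContinuousAt.continuousWithinAt ?_
    have h1 : ∀ᶠ p : M × DiscreteCopy W in nhds (x, c),
        p.2.val + (g i p.1 - g j p.1) = c.val + (g i x - g j x) := by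
      rw [nhds_prod_eq]
      have h2 : ∀ᶠ d in nhds c, d = c := by
        rw [nhds_discrete]; exact Filter.eventually_pure.2 rfl
      filter_upwards [(hg i j x hxc.1).prod_mk h2] with p hp
      rw [hp.1, hp.2]
    exact (continuousAt_const (y := (show DiscreteCopy W from
      (c.val + (g i x - g j x) : W)))).congr (h1.mono fun p hp => hp.symm)

/-- On a simply connected surface a form with local primitives has a global one: a section of the
covering by germs of primitives. -/
theorem exists_primitive_of_local [SimplyConnectedSpace M]
    {α : ∀ x : M, TangentSpace (𝓡 2) x →L[ℝ] W}
    (hα : ∀ x, ∃ (U : Set M) (g : M → W), IsOpen U ∧ x ∈ U ∧ IsPrimitiveOn g α U) :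
    ∃ G : M → W, IsPrimitiveOn G α Set.univ := by
  choose U g hU hx hg using hα
  have hloc : ∀ i j, ∀ x ∈ U i ∩ U j, ∀ᶠ y in nhds x, g i y - g j y = g i x - g j x := by
    intro i j x hxij
    refine eventually_eq_of_hasMFDerivAt_zero (D := fun y => g i y - g j y) ?_
    filter_upwards [((hU i).inter (hU j)).mem_nhds hxij] with y hy
    have := (hg i y hy.1).sub (hg j y hy.2)
    rwa [sub_self] at this
  let Z := primitiveCover U g hU hx hloc
  have hcov : IsCoveringMap (TotalSpace.proj : TotalSpace (DiscreteCopy W) Z.Fiber → M) :=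
    FiberBundle.isCoveringMap
  have : LocallyPathConnectedSpace M := ChartedSpace.locallyPathConnectedSpace (Eu 2) M
  obtain ⟨a₀⟩ : Nonempty M := inferInstance
  -- a section is a lift of the identity of `M`
  obtain ⟨s, ⟨-, hs⟩, -⟩ := hcov.existsUnique_continuousMap_lifts (ContinuousMap.id M) a₀
    ⟨a₀, (0 : W)⟩ rfl
  have hs' : ∀ x, (s x).proj = x := fun x => congrFun hs x
  refine ⟨fun x => (s x).2.val + g x x, fun x _ => ?_⟩
  have hcont : ContinuousAt (fun y => (Z.localTriv x (s y)).2) x := by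
    have h1 : ContinuousAt (Z.localTriv x) (s x) :=
      (Z.localTriv x).continuousAt ((Z.localTriv x).mem_source.2 (by
        change (s x).proj ∈ U x
        rw [hs']; exact hx x))
    exact continuousAt_snd.comp (ContinuousAt.comp (f := s) h1 s.continuous.continuousAt)
  -- the fibre is discrete, so the coordinate of the section is locally constant
  have hconst : ∀ᶠ y in nhds x, (Z.localTriv x (s y)).2 = (Z.localTriv x (s x)).2 := by
    have h2 := hcont.eventually (p := fun d => d = (Z.localTriv x (s x)).2)
      (by rw [nhds_discrete]; exact Filter.eventually_pure.2 rfl)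
    exact h2
  have hG : (fun y => (s y).2.val + g y y) =ᶠ[nhds x]
      fun y => (Z.localTriv x (s x)).2.val + g x y := by
    filter_upwards [hconst] with y hy
    rw [← hy]
    have h3 : (Z.localTriv x (s y)).2.val =
        (s y).2.val + (g (s y).proj (s y).proj - g x (s y).proj) := rfl
    rw [h3, hs']
    abel
  have h4 := (hasMFDerivAt_const (I := 𝓡 2) (I' := 𝓘(ℝ, W))
    (Z.localTriv x (s x)).2.val x).add (hg x x (hx x))
  exact (h4.congr_mfderiv (zero_add _)).congr_of_eventuallyEq hG

end Primitives

/-! ### Forms in a complex parameter -/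

section ComplexParameter

variable {M : Type*} [TopologicalSpace M] [ChartedSpace (Eu 2) M] [IsManifold (𝓡 2) ∞ M]
  [RiemannianBundle (fun x : M => TangentSpace (𝓡 2) x)]
  {oM : ∀ x : M, Orientation ℝ (TangentSpace (𝓡 2) x) (Fin 2)}
  {z : OpenPartialHomeomorph M ℂ}

/-- The derivative of the inverse of a local coordinate. -/
def symmDeriv (z : OpenPartialHomeomorph M ℂ) (w : ℂ) : ℂ →L[ℝ] TangentSpace (𝓡 2) (z.symm w) :=
  mfderiv 𝓘(ℝ, ℂ) (𝓡 2) z.symm w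

namespace IsComplexParameter

omit [IsManifold (𝓡 2) ∞ M] in
theorem mdifferentiableAt (hz : IsComplexParameter oM z) {x : M} (hx : x ∈ z.source) :
    MDifferentiableAt (𝓡 2) 𝓘(ℝ, ℂ) z x :=
  (hz.smooth.contMDiffAt (z.open_source.mem_nhds hx)).mdifferentiableAt (by decide)

omit [IsManifold (𝓡 2) ∞ M] in
theorem contMDiffAt_symm (hz : IsComplexParameter oM z) {w : ℂ} (hw : w ∈ z.target) :
    ContMDiffAt 𝓘(ℝ, ℂ) (𝓡 2) ∞ z.symm w :=
  hz.smooth_symm.contMDiffAt (z.open_target.mem_nhds hw)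

omit [IsManifold (𝓡 2) ∞ M] in
theorem mdifferentiableAt_symm (hz : IsComplexParameter oM z) {w : ℂ} (hw : w ∈ z.target) :
    MDifferentiableAt 𝓘(ℝ, ℂ) (𝓡 2) z.symm w :=
  (hz.contMDiffAt_symm hw).mdifferentiableAt (by decide)

omit [IsManifold (𝓡 2) ∞ M] in
theorem dirDeriv_symmDeriv (hz : IsComplexParameter oM z) {w : ℂ} (hw : w ∈ z.target) (v : ℂ) :
    dirDeriv z (z.symm w) (symmDeriv z w v) = v := by
  have h := (hz.mdifferentiableAt (z.map_target hw)).hasMFDerivAt.comp w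
    (hz.mdifferentiableAt_symm hw).hasMFDerivAt
  have h' : HasMFDerivAt 𝓘(ℝ, ℂ) 𝓘(ℝ, ℂ) (z ∘ z.symm) w (ContinuousLinearMap.id ℝ ℂ) := by
    refine (hasMFDerivAt_id w).congr_of_eventuallyEq ?_
    filter_upwards [z.open_target.mem_nhds hw] with y hy using z.right_inv hy
  exact congrArg (fun L : ℂ →L[ℝ] ℂ => L v) (hasMFDerivAt_unique h h')

omit [IsManifold (𝓡 2) ∞ M] in
theorem symmDeriv_dirDeriv (hz : IsComplexParameter oM z) {w : ℂ} (hw : w ∈ z.target)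
    (X : TangentSpace (𝓡 2) (z.symm w)) :
    symmDeriv z w (dirDeriv z (z.symm w) X) = X := by
  -- the derivative of `z⁻¹` is injective, so surjective
  have hA : Function.Injective (symmDeriv z w).toLinearMap := fun u v huv => by
    rw [← hz.dirDeriv_symmDeriv hw u, ← hz.dirDeriv_symmDeriv hw v]
    exact congrArg (dirDeriv z (z.symm w)) huv
  have hfr : Module.finrank ℝ ℂ = Module.finrank ℝ (TangentSpace (𝓡 2) (z.symm w)) := by
    rw [Complex.finrank_real_complex]
    exact (finrank_euclideanSpace_fin (𝕜 := ℝ) (n := 2)).symm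
  obtain ⟨v, hv⟩ := (LinearMap.injective_iff_surjective_of_finrank_eq_finrank hfr).1 hA X
  have hv' : symmDeriv z w v = X := hv
  rw [← hv', hz.dirDeriv_symmDeriv hw]

omit [IsManifold (𝓡 2) ∞ M] in
theorem symmDeriv_I (hz : IsComplexParameter oM z) {w : ℂ} (hw : w ∈ z.target) :
    symmDeriv z w Complex.I = J oM (z.symm w) (symmDeriv z w 1) := by
  rw [← hz.symmDeriv_dirDeriv hw (J oM (z.symm w) (symmDeriv z w 1)),
    hz.mfderiv_J _ (z.map_target hw), hz.dirDeriv_symmDeriv hw, mul_one]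

variable {n : ℕ} {α : ∀ x : M, TangentSpace (𝓡 2) x →L[ℝ] Ec n}

omit [IsManifold (𝓡 2) ∞ M] in
/-- In a complex parameter, a `ℂ`-linear form is `f̃ dz`. -/
theorem apply_symmDeriv (hz : IsComplexParameter oM z)
    (hJ : ∀ x X, α x (J oM x X) = Complex.I • α x X) {w : ℂ} (hw : w ∈ z.target) (v : ℂ) :
    α (z.symm w) (symmDeriv z w v) = v • coeff α z w := by
  have h1 : symmDeriv z w v = v.re • symmDeriv z w 1 + v.im • symmDeriv z w Complex.I := by
    rw [← map_smul, ← map_smul, ← map_add]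
    congr 1
    apply Complex.ext <;> simp
  have h2 : coeff α z w = α (z.symm w) (symmDeriv z w 1) := rfl
  rw [h1, hz.symmDeriv_I hw, map_add, map_smul, map_smul, hJ, h2]
  conv_rhs => rw [← Complex.re_add_im v, add_smul, mul_smul]
  simp only [Complex.coe_smul]

omit [IsManifold (𝓡 2) ∞ M] in
theorem eq_dirDeriv_smul_coeff (hz : IsComplexParameter oM z)
    (hJ : ∀ x X, α x (J oM x X) = Complex.I • α x X) {x : M} (hx : x ∈ z.source)
    (X : TangentSpace (𝓡 2) x) : α x X = dirDeriv z x X • coeff α z (z x) := by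
  obtain ⟨w, hw, rfl⟩ : ∃ w ∈ z.target, z.symm w = x := ⟨z x, z.map_source hx, z.left_inv hx⟩
  rw [z.right_inv hw, ← hz.apply_symmDeriv hJ hw, hz.symmDeriv_dirDeriv hw]

/-- The coefficient of a closed `ℂ`-linear form is holomorphic: `d(f̃ dz) = 0` is the
Cauchy-Riemann equation. -/
theorem differentiableAt_coeff (hz : IsComplexParameter oM z)
    (hJ : ∀ x X, α x (J oM x X) = Complex.I • α x X) (hα : IsClosedForm α) {w : ℂ}
    (hw : w ∈ z.target) : DifferentiableAt ℂ (coeff α z) w := by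
  let β : ℂ → ℂ →L[ℝ] Ec n := fun y => (α (z.symm y)).comp (symmDeriv z y)
  obtain ⟨h1, h2⟩ := dForm_pullback (β := β) ((hz.contMDiffAt_symm hw).of_le (by norm_cast))
    (((hα.1 _).contDiffAt (extChartAt_target_mem_nhds _)).differentiableAt (by decide))
    (Filter.Eventually.of_forall fun y v => rfl)
  have h3 : ∀ v : ℂ, HasFDerivAt (fun y => β y v) ((fderiv ℝ β w).flip v) w := fun v => by
    simpa using! h1.hasFDerivAt.clm_apply (hasFDerivAt_const v w)
  have h4 : HasFDerivAt (coeff α z) ((fderiv ℝ β w).flip 1) w := h3 1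
  -- `β(i) = i β(1)`, and closedness makes the derivative of `β` symmetric
  have h5 : (fun y => β y Complex.I) =ᶠ[nhds w] fun y => Complex.I • coeff α z y := by
    filter_upwards [z.open_target.mem_nhds hw] with y hy using hz.apply_symmDeriv hJ hy _
  have h6 := (h3 Complex.I).unique ((h4.const_smul Complex.I).congr_of_eventuallyEq h5)
  rw [differentiableAt_complex_iff_differentiableAt_real]
  refine ⟨h4.differentiableAt, ?_⟩
  rw [h4.fderiv]
  have h7 := congrArg (fun L : ℂ →L[ℝ] Ec n => L 1) h6
  simp only [ContinuousLinearMap.flip_apply, smul_apply] at h7 ⊢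
  rw [← h7, ← sub_eq_zero, h2]
  exact hα.2 _ _ _

omit [IsManifold (𝓡 2) ∞ M] in
theorem hasDerivAt_primitive (hz : IsComplexParameter oM z)
    (hJ : ∀ x X, α x (J oM x X) = Complex.I • α x X) {G : M → Ec n} {w : ℂ} (hw : w ∈ z.target)
    (hG : HasMFDerivAt (𝓡 2) 𝓘(ℝ, Ec n) G (z.symm w) (α (z.symm w))) :
    HasDerivAt (fun w' => G (z.symm w')) (coeff α z w) w := by
  have h1 := hG.comp w (hz.mdifferentiableAt_symm hw).hasMFDerivAt
  have h2 : HasFDerivAt (𝕜 := ℝ) (fun w' => G (z.symm w')) _ w := hasMFDerivAt_iff_hasFDerivAt.1 h1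
  refine hasFDerivAt_of_restrictScalars ℝ h2 ?_
  refine ContinuousLinearMap.ext fun v => ?_
  refine Eq.trans ?_ (hz.apply_symmDeriv hJ hw v).symm
  simp

end IsComplexParameter

/-- The real part `ℂⁿ → ℝⁿ` as a continuous linear map. -/
def reCL (n : ℕ) : Ec n →L[ℝ] Eu n :=
  LinearMap.toContinuousLinearMap
    { toFun := reC
      map_add' := fun v w => by ext j; simp [reC]
      map_smul' := fun c v => by ext j; simp [reC] }

theorem reCL_apply {n : ℕ} (v : Ec n) : reCL n v = reC v := rfl

omit [IsManifold (𝓡 2) ∞ M] in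
/-- The formula `F = Re ∫ f̃ dz` along a path, for a primitive `F` of the real part of `f̃ dz`. -/
theorem IsComplexParameter.primitive_eq_curveIntegral {n : ℕ}
    {α : ∀ x : M, TangentSpace (𝓡 2) x →L[ℝ] Ec n} {ξ : ∀ x : M, TangentSpace (𝓡 2) x →L[ℝ] Eu n}
    (hz : IsComplexParameter oM z) (hJ : ∀ x X, α x (J oM x X) = Complex.I • α x X)
    (hξ : ∀ x X, reC (α x X) = ξ x X) (hc : ContinuousOn (coeff α z) z.target)
    {F : M → Eu n} (hF : IsPrimitiveOn F ξ z.source) {a b : ℂ} (γ : Path a b)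
    (hγ : ∀ t, γ t ∈ z.target) (hγ' : ContDiffOn ℝ 1 γ.extend (Set.Icc 0 1)) :
    F (z.symm b) = F (z.symm a) + reC (curveIntegral
      (fun w => (ContinuousLinearMap.id ℂ ℂ).smulRight (coeff α z w)) γ) := by
  have hγt : ∀ t ∈ Set.Icc (0 : ℝ) 1, γ.extend t ∈ z.target := fun t ht => by
    rw [γ.extend_apply ht]; exact hγ _
  -- the derivative of `F ∘ z⁻¹ ∘ γ`
  have hd : ∀ t ∈ Set.Icc (0 : ℝ) 1, HasDerivWithinAt (fun t => F (z.symm (γ.extend t)))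
      (reC (derivWithin γ.extend (Set.Icc 0 1) t • coeff α z (γ.extend t))) (Set.Icc 0 1) t := by
    intro t ht
    have h1 := (hF _ (z.map_target (hγt t ht))).comp (γ.extend t)
      (hz.mdifferentiableAt_symm (hγt t ht)).hasMFDerivAt
    have h2 : HasFDerivAt (𝕜 := ℝ) (fun w' => F (z.symm w')) _ (γ.extend t) :=
      hasMFDerivAt_iff_hasFDerivAt.1 h1
    have h3 := ((hγ'.differentiableOn (by decide)) t ht).hasDerivWithinAt
    have h4 := h2.comp_hasDerivWithinAt t h3
    rw [← hz.apply_symmDeriv hJ (hγt t ht), hξ]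
    exact h4
  have hcont : ContinuousOn
      (fun t => derivWithin γ.extend (Set.Icc 0 1) t • coeff α z (γ.extend t)) (Set.Icc 0 1) :=
    (hγ'.continuousOn_derivWithin (uniqueDiffOn_Icc_zero_one) le_rfl).smul
      (hc.comp γ.continuous_extend.continuousOn hγt)
  have hint : IntervalIntegrable
      (fun t => derivWithin γ.extend (Set.Icc 0 1) t • coeff α z (γ.extend t))
      MeasureTheory.volume 0 1 := by
    refine ContinuousOn.intervalIntegrable ?_
    rwa [Set.uIcc_of_le zero_le_one]
  have h5 := intervalIntegral.integral_eq_sub_of_hasDeriv_right_of_le zero_le_one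
    (fun t ht => (hd t ht).continuousWithinAt)
    (fun t ht => ((hd t (Set.Ioo_subset_Icc_self ht)).mono_of_mem_nhdsWithin
      (mem_nhdsWithin_of_mem_nhds (Icc_mem_nhds ht.1 ht.2)) :
        HasDerivWithinAt _ _ (Set.Ioi t) t))
    (f' := fun t => reC (derivWithin γ.extend (Set.Icc 0 1) t • coeff α z (γ.extend t)))
    (by
      refine ContinuousOn.intervalIntegrable ?_
      rw [Set.uIcc_of_le zero_le_one]
      exact (reCL n).continuous.comp_continuousOn hcont)
  have h6 := (reCL n).intervalIntegral_comp_comm hint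
  simp only [reCL_apply] at h6
  rw [curveIntegral_def]
  simp only [curveIntegralFun_def, ContinuousLinearMap.smulRight_apply,
    ContinuousLinearMap.id_apply]
  rw [← h6, h5]
  simp

end ComplexParameter

/-! ### Spinorial frames -/

section CliffordCalculus

variable {n : ℕ}

/-- The bilinear map `(a, b) ↦ τ(a) c b`, followed by the projection to `ℝⁿ`. -/
def conjBilin (c : Cl n) : Cl n →L[ℝ] Cl n →L[ℝ] Eu n :=
  LinearMap.toContinuousLinearMap (LinearMap.toContinuousLinearMap.toLinearMap ∘ₗ
    LinearMap.mk₂ ℝ (fun a b => toVec n (tau a * c * b))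
      (fun a a' b => by simp [add_mul])
      (fun r a b => by simp)
      (fun a b b' => by simp [mul_add])
      (fun r a b => by simp))

theorem conjBilin_apply (c a b : Cl n) : conjBilin c a b = toVec n (tau a * c * b) := rfl

theorem contDiff_conj (c : Cl n) : ContDiff ℝ ∞ (fun f : Cl n => toVec n (tau f * c * f)) :=
  (conjBilin c).contDiff.clm_apply contDiff_id

theorem hasFDerivAt_conj (c f : Cl n) :
    HasFDerivAt (fun f : Cl n => toVec n (tau f * c * f))
      (conjBilin c f + (conjBilin c).flip f) f := by
  have h := (conjBilin c).hasFDerivAt (x := f) |>.clm_apply (hasFDerivAt_id f)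
  simpa using! h

/-- If `f' = A f` with `τ(A) = -A`, then `τ(f) c f` has the derivative `τ(f) [c, A] f`. -/
theorem conj_deriv_of_tau_eq_neg (c f A : Cl n) (hA : tau A = -A) :
    (conjBilin c f + (conjBilin c).flip f) (A * f) =
      toVec n (tau f * ((c * A - A * c) * f)) := by
  simp only [add_apply, ContinuousLinearMap.flip_apply, conjBilin_apply,
    ← map_add, CliffordAlgebra.reverse.map_mul, hA]
  congr 1
  noncomm_ring

end CliffordCalculus

section Frames

variable {M : Type*} [TopologicalSpace M] [ChartedSpace (Eu 2) M]

section

variable {k : ℕ} {V : M → Type*}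
    [TopologicalSpace (TotalSpace (Eu k) V)]
    [∀ x, NormedAddCommGroup (V x)] [∀ x, InnerProductSpace ℝ (V x)] [FiberBundle (Eu k) V]
    {o : ∀ x, Orientation ℝ (V x) (Fin k)}

theorem SpinStructure.IsLocalFrame.mono {S : SpinStructure k V o} {s : ∀ x, S.P x} {U U' : Set M}
    (h : S.IsLocalFrame s U) (hU : IsOpen U') (hUU : U' ⊆ U) : S.IsLocalFrame s U' where
  isOpen := hU
  continuousOn := by
    let _ := S.top
    exact ContinuousOn.mono h.continuousOn hUU
  smooth j := (h.smooth j).mono hUU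

theorem SpinStructure.exists_isLocalFrame (S : SpinStructure k V o) (x : M) :
    ∃ (s : ∀ x, S.P x) (U : Set M), S.IsLocalFrame s U ∧ x ∈ U := by
  let _ := S.top
  obtain ⟨e, s, hx, -, h1, h2⟩ := S.locallyTrivial x
  refine ⟨s, e.baseSet, ⟨e.open_baseSet, ?_, h2⟩, hx⟩
  have h3 : ∀ y ∈ e.baseSet, e.toOpenPartialHomeomorph.symm (y, 1) =
      TotalSpace.mk' (Spin k) y (s y) := by
    intro y hy
    have hm : TotalSpace.mk' (Spin k) y (s y) ∈ e.source := e.mem_source.2 hy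
    have h4 : e (TotalSpace.mk' (Spin k) y (s y)) = (y, 1) :=
      Prod.ext (e.coe_fst hm) (h1 y hy)
    rw [← h4]
    exact e.toOpenPartialHomeomorph.left_inv hm
  have h5 : ContinuousOn (fun y : M => e.toOpenPartialHomeomorph.symm (y, (1 : Spin k)))
      e.baseSet :=
    e.toOpenPartialHomeomorph.continuousOn_symm.comp (by fun_prop) fun y hy => e.mem_target.2 hy
  exact h5.congr fun y hy => (h3 y hy).symm

variable [VectorBundle ℝ (Eu k) V] [ContMDiffVectorBundle 1 (Eu k) V (𝓡 2)]
  [IsContMDiffRiemannianBundle (𝓡 2) 1 (Eu k) V]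
  [IsManifold (𝓡 2) ∞ M]

/-- The connection form of a metric connection in an orthonormal frame is antisymmetric. -/
theorem inner_cov_frame_antisymm {cov : CovariantDerivative (𝓡 2) (Eu k) V}
    (hcov : cov.IsMetricCompatible) {S : SpinStructure k V o} {s : ∀ x, S.P x} {U : Set M}
    (hs : S.IsLocalFrame s U) {x : M} (hx : x ∈ U) (X : TangentSpace (𝓡 2) x) (a b : Fin k) :
    inner ℝ (cov (fun y => S.frame (s y) a) x X) (S.frame (s x) b) =
      -inner ℝ (cov (fun y => S.frame (s y) b) x X) (S.frame (s x) a) := by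
  have hd : ∀ a, MDifferentiableAt (𝓡 2) ((𝓡 2).prod 𝓘(ℝ, Eu k))
      (fun x => TotalSpace.mk' (Eu k) x (S.frame (s x) a)) x := fun a =>
    ((hs.smooth a).contMDiffAt (hs.isOpen.mem_nhds hx)).mdifferentiableAt (by decide)
  have h := hcov.mvfderiv_inner_eq (FiberBundle.extend (Eu 2) X) (hd a) (hd b)
  have hc : (fun y => (inner ℝ (S.frame (s y) a) (S.frame (s y) b) : ℝ)) =
      fun _ => if a = b then 1 else 0 := by
    funext y
    exact orthonormal_iff_ite.1 (S.frame (s y)).orthonormal a b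
  rw [hc] at h
  simp only [FiberBundle.extend_apply_self] at h
  rw [mvfderiv_const] at h
  have h' : (0 : ℝ) = inner ℝ (cov (fun y => S.frame (s y) a) x X) (S.frame (s x) b) +
    inner ℝ (S.frame (s x) a) (cov (fun y => S.frame (s y) b) x X) := h
  rw [real_inner_comm (cov (fun y => S.frame (s y) b) x X)] at h'
  linarith

end
end Frames

/-! ### The derivative of `ξ` in a spinorial frame -/

section OrthonormalFrames

/-- The trace of a bilinear map over an orthonormal basis does not depend on the basis. -/
theorem sum_bilin_orthonormalBasis {T F ι κ : Type*} [NormedAddCommGroup T] [InnerProductSpace ℝ T]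
    [AddCommGroup F] [Module ℝ F] [Fintype ι] [Fintype κ] (B : T →ₗ[ℝ] T →ₗ[ℝ] F)
    (b : OrthonormalBasis ι ℝ T) (b' : OrthonormalBasis κ ℝ T) :
    ∑ i, B (b i) (b i) = ∑ j, B (b' j) (b' j) := by
  classical
  have h1 : ∀ i, B (b i) (b i) =
      ∑ j, ∑ l, (inner ℝ (b' j) (b i) * inner ℝ (b i) (b' l)) • B (b' j) (b' l) := by
    intro i
    have e := b'.sum_repr' (b i)
    conv_lhs => rw [← e]
    simp only [map_sum, LinearMap.sum_apply, map_smul, LinearMap.smul_apply, Finset.smul_sum,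
      smul_smul]
    rw [Finset.sum_comm]
    refine Finset.sum_congr rfl fun j _ => Finset.sum_congr rfl fun l _ => ?_
    rw [real_inner_comm (b i) (b' l), mul_comm]
  simp only [h1]
  rw [Finset.sum_comm]
  refine Finset.sum_congr rfl fun j _ => ?_
  rw [Finset.sum_comm]
  simp only [← Finset.sum_smul, b.sum_inner_mul_inner, orthonormal_iff_ite.1 b'.orthonormal]
  simp

variable {M : Type*} [TopologicalSpace M] [ChartedSpace (Eu 2) M] [IsManifold (𝓡 2) ∞ M]
  [RiemannianBundle (fun x : M => TangentSpace (𝓡 2) x)]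
  {oM : ∀ x : M, Orientation ℝ (TangentSpace (𝓡 2) x) (Fin 2)}

omit [IsManifold (𝓡 2) ∞ M] in
theorem J_J (x : M) (X : TangentSpace (𝓡 2) x) : J oM x (J oM x X) = -X := by
  have : Fact (Module.finrank ℝ (TangentSpace (𝓡 2) x) = 2) := ⟨finrank_euclideanSpace_fin⟩
  exact (oM x).rightAngleRotation_rightAngleRotation X

omit [IsManifold (𝓡 2) ∞ M] in
/-- `J e₁ = e₂` for a positively oriented orthonormal frame. -/
theorem J_frame_zero {x : M} (b : OrthonormalBasis (Fin 2) ℝ (TangentSpace (𝓡 2) x))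
    (hb : b.toBasis.orientation = oM x) : J oM x (b 0) = b 1 := by
  have : Fact (Module.finrank ℝ (TangentSpace (𝓡 2) x) = 2) := ⟨finrank_euclideanSpace_fin⟩
  have h0 : inner ℝ ((oM x).rightAngleRotation (b 0)) (b 0) = 0 := by
    rw [(oM x).inner_rightAngleRotation_left, (oM x).areaForm_apply_self]
  have h1 : inner ℝ ((oM x).rightAngleRotation (b 0)) (b 1) = 1 := by
    rw [(oM x).inner_rightAngleRotation_left, (oM x).areaForm_to_volumeForm,
      (oM x).volumeForm_robust b hb]
    have : ![b 0, b 1] = b.toBasis := by ext i; fin_cases i <;> simp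
    rw [this, Module.Basis.det_self]
  have h2 := b.sum_repr' ((oM x).rightAngleRotation (b 0))
  rw [Fin.sum_univ_two, real_inner_comm, h0, real_inner_comm, h1, zero_smul, one_smul,
    zero_add] at h2
  exact h2.symm

omit [IsManifold (𝓡 2) ∞ M] in
theorem J_frame_one {x : M} (b : OrthonormalBasis (Fin 2) ℝ (TangentSpace (𝓡 2) x))
    (hb : b.toBasis.orientation = oM x) : J oM x (b 1) = -b 0 := by
  rw [← J_frame_zero b hb, J_J]

variable {q : ℕ} {E : M → Type*}
    [∀ x, NormedAddCommGroup (E x)] [∀ x, InnerProductSpace ℝ (E x)]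

omit [IsManifold (𝓡 2) ∞ M] in
theorem two_smul_meanCurvature
    (B : ∀ x : M, TangentSpace (𝓡 2) x →ₗ[ℝ] TangentSpace (𝓡 2) x →ₗ[ℝ] E x)
    {x : M} (b : OrthonormalBasis (Fin 2) ℝ (TangentSpace (𝓡 2) x)) :
    (2 : ℝ) • meanCurvature B x = B x (b 0) (b 0) + B x (b 1) (b 1) := by
  rw [meanCurvature, smul_smul, sum_bilin_orthonormalBasis (B x) _ b, Fin.sum_univ_two]
  norm_num

end OrthonormalFrames

section XiForms

variable {M : Type*} [TopologicalSpace M] [ChartedSpace (Eu 2) M] [IsManifold (𝓡 2) ∞ M]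
  [RiemannianBundle (fun x : M => TangentSpace (𝓡 2) x)]
  {oM : ∀ x : M, Orientation ℝ (TangentSpace (𝓡 2) x) (Fin 2)}
  {q : ℕ} {E : M → Type*} [TopologicalSpace (TotalSpace (Eu q) E)]
  [∀ x, NormedAddCommGroup (E x)] [∀ x, InnerProductSpace ℝ (E x)] [FiberBundle (Eu q) E]
  {oE : ∀ x : M, Orientation ℝ (E x) (Fin q)}
  {SM : SpinStructure 2 (fun x : M => TangentSpace (𝓡 2) x) oM} {SE : SpinStructure q E oE}
  (φ : SpinorField SM SE)

namespace SpinorField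

theorem xiTilde_apply (x : M) (X : TangentSpace (𝓡 2) x) :
    φ.xiTilde x X = toC (2 + q) (φ.xi x (X, 0)) -
      Complex.I • toC (2 + q) (φ.xi x (J oM x X, 0)) := rfl

theorem xiTilde_J (x : M) (X : TangentSpace (𝓡 2) x) :
    φ.xiTilde x (J oM x X) = Complex.I • φ.xiTilde x X := by
  have e : φ.xi x (-X, 0) = -φ.xi x (X, 0) := by
    rw [← map_neg]; simp
  rw [xiTilde_apply, xiTilde_apply, J_J, e, map_neg, smul_sub, smul_smul, Complex.I_mul_I]
  module

theorem reC_xiTilde (x : M) (X : TangentSpace (𝓡 2) x) :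
    reC (φ.xiTilde x X) = φ.xiForm x X := by
  rw [xiTilde_apply]
  change _ = φ.xi x (X, 0)
  ext j
  simp [reC, toC]

/-- `ξ` is injective, as `τ([φ])` is inverse to `[φ]`. -/
theorem eq_zero_of_xi_eq_zero (hφ : φ.IsUnit) {x : M} {v : TangentSpace (𝓡 2) x × E x}
    (h : φ.xi x v = 0) : v = 0 := by
  obtain ⟨u⟩ := SM.nonempty x
  obtain ⟨w⟩ := SE.nonempty x
  have h1 := φ.vec_xi hφ x v
  have hv0 : vec (0 : Eu (2 + q)) = 0 := map_zero (CliffordAlgebra.ι (negSq (2 + q)))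
  rw [h, φ.xiCl_eq u w] at h1
  let a : Spin (2 + q) := ⟨φ.coord u w, hφ u w⟩
  have h2 : tau (a : Cl (2 + q)) * (vec (coordVec u w v) * (a : Cl (2 + q))) = 0 :=
    h1.symm.trans hv0
  have h3 : vec (coordVec u w v) = 0 := by
    have h4 : (a : Cl (2 + q)) * (tau (a : Cl (2 + q)) *
      (vec (coordVec u w v) * (a : Cl (2 + q)))) * tau (a : Cl (2 + q)) = 0 := by
      rw [h2, mul_zero, zero_mul]
    rwa [← mul_assoc, mul_tau_self, one_mul, mul_assoc, mul_tau_self, mul_one] at h4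
  have h5 : coordVec u w v = 0 := by rw [← toVec_vec (coordVec u w v), h3, map_zero]
  obtain ⟨h6, h7⟩ := eq_zero_of_inclL_add_inclR_eq_zero (v := (SM.frame u).repr v.1)
    (w := (SE.frame w).repr v.2) h5
  exact Prod.ext (by simpa using h6) (by simpa using h7)

theorem toC_injective (n : ℕ) : Function.Injective (toC n) := fun v w h => by
  ext j
  simpa [toC] using congrArg (fun z : Ec n => z j) h

theorem coordVec_frame {x : M} (u : SM.P x) (w : SE.P x) (a : Fin 2) :
    coordVec u w (SM.frame u a, 0) = inclL 2 q (EuclideanSpace.single a 1) := by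
  simp [coordVec]

/-- `ξ(e_a)` in a spinorial frame. -/
theorem xi_frame {x : M} (u : SM.P x) (w : SE.P x) (a : Fin 2) :
    φ.xi x (SM.frame u a, 0) = toVec (2 + q) (tau (φ.coord u w) *
      vec (inclL 2 q (EuclideanSpace.single a 1)) * φ.coord u w) := by
  change toVec (2 + q) (φ.xiCl x _) = _
  rw [φ.xiCl_eq u w, coordVec_frame, bracket, mul_assoc]

theorem contMDiffAt_xi_frame {s : ∀ x, SM.P x} {t : ∀ x, SE.P x} {U : Set M}
    (hs : SM.IsLocalFrame s U) (ht : SE.IsLocalFrame t U) {x : M} (hx : x ∈ U) (a : Fin 2) :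
    ContMDiffAt (𝓡 2) 𝓘(ℝ, Eu (2 + q)) ∞ (fun y => φ.xi y (SM.frame (s y) a, 0)) x := by
  have h1 := (φ.smooth s t U hs ht).contMDiffAt (hs.isOpen.mem_nhds hx)
  have h2 := ContMDiffAt.comp x
    (contDiff_conj (vec (inclL 2 q (EuclideanSpace.single a 1)))).contMDiff.contMDiffAt h1
  refine h2.congr_of_eventuallyEq (Filter.Eventually.of_forall fun y => ?_)
  exact φ.xi_frame (s y) (t y) a

end SpinorField

variable [VectorBundle ℝ (Eu q) E] [ContMDiffVectorBundle 1 (Eu q) E (𝓡 2)]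
  [IsContMDiffRiemannianBundle (𝓡 2) 1 (Eu q) E]
  [IsContMDiffRiemannianBundle (𝓡 2) 1 (Eu 2) (fun x : M => TangentSpace (𝓡 2) x)]
  {covM : CovariantDerivative (𝓡 2) (Eu 2) (fun x : M => TangentSpace (𝓡 2) x)}
  {covE : CovariantDerivative (𝓡 2) (Eu q) E}
  {B : ∀ x : M, TangentSpace (𝓡 2) x →ₗ[ℝ] TangentSpace (𝓡 2) x →ₗ[ℝ] E x}

/-- The Killing type equation says that `∂_X ξ(e_a) = ξ(∇_X e_a + B(X, e_a))`. -/
theorem SpinorField.IsKilling.dirDeriv_xi_frame {φ : SpinorField SM SE}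
    (hφ : φ.IsKilling covM covE B) (hM : covM.IsMetricCompatible) (hE : covE.IsMetricCompatible)
    {s : ∀ x, SM.P x} {t : ∀ x, SE.P x} {U : Set M}
    (hs : SM.IsLocalFrame s U) (ht : SE.IsLocalFrame t U) {x : M} (hx : x ∈ U) (a : Fin 2)
    (X : TangentSpace (𝓡 2) x) :
    dirDeriv (fun y => φ.xi y (SM.frame (s y) a, 0)) x X =
      φ.xi x (covM (fun y => SM.frame (s y) a) x X, B x X (SM.frame (s x) a)) := by
  set f : M → Cl (2 + q) := fun y => φ.coord (s y) (t y) with hf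
  set c : Cl (2 + q) := vec (inclL 2 q (EuclideanSpace.single a 1)) with hc
  -- `Ω` and `η` are the coefficients of `∇` and of the right-hand side of the equation
  set Ω := spinConnection covM covE s t x X with hΩ
  set η : Cl (2 + q) := killingElt fun j => (SE.frame (t x)).repr (B x X (SM.frame (s x) j)) with hη
  have hk := hφ s t U hs ht x hx X
  have hk' : dirDeriv f x X = (η - Ω) * f x := by
    have e : -(1 / 2 : ℝ) • ∑ j : Fin 2,
        vec (coordVec (s x) (t x) (SM.frame (s x) j, 0)) *
          vec (coordVec (s x) (t x) (0, B x X (SM.frame (s x) j))) * φ.coord (s x) (t x) =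
        η * f x := by
      rw [hη, killingElt, smul_mul_assoc, Finset.sum_mul]
      simp only [coordVec_frame]
      simp [coordVec, hf]
    rw [e, nabla] at hk
    rw [sub_mul, ← hk]
    exact (add_sub_cancel_right _ _).symm
  have hΩ' : Ω = bivector (fun i => inclL 2 q (EuclideanSpace.single i 1))
        (fun a b => inner ℝ (covM (fun y => SM.frame (s y) a) x X) (SM.frame (s x) b)) +
      bivector (fun i => inclR 2 q (EuclideanSpace.single i 1))
        (fun a b => inner ℝ (covE (fun y => SE.frame (t y) a) x X) (SE.frame (t x) b)) := rfl
  have hcomm := commutator_spinConnection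
    (fun a b => inner ℝ (covM (fun y => SM.frame (s y) a) x X) (SM.frame (s x) b))
    (fun a b => inner ℝ (covE (fun y => SE.frame (t y) a) x X) (SE.frame (t x) b))
    (fun a b => inner_cov_frame_antisymm hM hs hx X a b)
    (fun a b => inner_cov_frame_antisymm hE ht hx X a b) a
    ((SM.frame (s x)).repr (covM (fun y => SM.frame (s y) a) x X)) (fun b => by
      rw [OrthonormalBasis.repr_apply_apply, real_inner_comm])
  rw [← hΩ', ← hc] at hcomm
  have hcomm' := commutator_killingElt
    (fun j => (SE.frame (t x)).repr (B x X (SM.frame (s x) j))) a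
  rw [← hη, ← hc] at hcomm'
  have horth : ∀ k (i j : Fin k), i ≠ j →
      inner ℝ (EuclideanSpace.single i (1 : ℝ)) (EuclideanSpace.single j (1 : ℝ)) = (0 : ℝ) := by
    intro k i j hij
    simp [EuclideanSpace.inner_single_left, hij]
  have htau : tau (η - Ω) = -(η - Ω) := by
    rw [map_sub, hΩ', map_add, tau_bivector _ _ fun i j hij => ?_,
      tau_bivector _ _ fun i j hij => ?_, hη, tau_killingElt]
    · abel
    · rw [inner_inclR_inclR, horth _ _ _ hij]
    · rw [inner_inclL_inclL, horth _ _ _ hij]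
  have h1 : HasMFDerivAt (𝓡 2) 𝓘(ℝ, Cl (2 + q)) f x (mfderiv (𝓡 2) 𝓘(ℝ, Cl (2 + q)) f x) :=
    (((φ.smooth s t U hs ht).contMDiffAt (hs.isOpen.mem_nhds hx)).mdifferentiableAt
      (by decide)).hasMFDerivAt
  have h2 := HasMFDerivAt.comp x (hasFDerivAt_conj c (f x)).hasMFDerivAt h1
  have h3 : (fun y => φ.xi y (SM.frame (s y) a, 0)) =
      (fun f => toVec (2 + q) (tau f * c * f)) ∘ f := by
    funext y
    exact φ.xi_frame (s y) (t y) a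
  rw [dirDeriv, h3, h2.mfderiv]
  have h4 : (conjBilin c (f x) + (conjBilin c).flip (f x)) (dirDeriv f x X) =
      φ.xi x (covM (fun y => SM.frame (s y) a) x X, B x X (SM.frame (s x) a)) := by
    rw [hk', conj_deriv_of_tau_eq_neg _ _ _ htau]
    change _ = toVec (2 + q) (φ.xiCl x _)
    rw [φ.xiCl_eq (s x) (t x), bracket]
    congr 3
    have e : c * (η - Ω) - (η - Ω) * c = (Ω * c - c * Ω) - (η * c - c * η) := by noncomm_ring
    rw [e, hcomm, hcomm', sub_neg_eq_add, ← map_add]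
    rfl
  exact h4

end XiForms

/-! ### The exterior derivative of `ξ̃` -/

section Derivatives

variable {M : Type*} [TopologicalSpace M] [ChartedSpace (Eu 2) M]

/-- The inclusion `ℝⁿ ⊆ ℂⁿ` as a continuous linear map. -/
def toCL (n : ℕ) : Eu n →L[ℝ] Ec n := LinearMap.toContinuousLinearMap (toC n)

theorem contMDiffAt_toC_sub {n : ℕ} {u v : M → Eu n} {x : M}
    (hu : ContMDiffAt (𝓡 2) 𝓘(ℝ, Eu n) ∞ u x) (hv : ContMDiffAt (𝓡 2) 𝓘(ℝ, Eu n) ∞ v x) :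
    ContMDiffAt (𝓡 2) 𝓘(ℝ, Ec n) ∞ (fun y => toC n (u y) - Complex.I • toC n (v y)) x :=
  ((toCL n).contDiff.contMDiff.contMDiffAt.comp x hu).sub
    ((Complex.I • toCL n).contDiff.contMDiff.contMDiffAt.comp x hv)

theorem dirDeriv_toC_sub {n : ℕ} {u v : M → Eu n} {x : M}
    (hu : ContMDiffAt (𝓡 2) 𝓘(ℝ, Eu n) ∞ u x) (hv : ContMDiffAt (𝓡 2) 𝓘(ℝ, Eu n) ∞ v x)
    (X : TangentSpace (𝓡 2) x) :
    dirDeriv (fun y => toC n (u y) - Complex.I • toC n (v y)) x X =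
      toC n (dirDeriv u x X) - Complex.I • toC n (dirDeriv v x X) := by
  have h1 := HasMFDerivAt.comp x (toCL n).hasFDerivAt.hasMFDerivAt
    (hu.mdifferentiableAt (by decide)).hasMFDerivAt
  have h2 := HasMFDerivAt.comp x (Complex.I • toCL n).hasFDerivAt.hasMFDerivAt
    (hv.mdifferentiableAt (by decide)).hasMFDerivAt
  rw [dirDeriv]
  have h3 := h1.sub h2
  have h4 : mfderiv (𝓡 2) 𝓘(ℝ, Ec n) (fun y => toC n (u y) - Complex.I • toC n (v y)) x = _ :=
    h3.mfderiv
  rw [h4]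
  rfl

theorem dirDeriv_congr {W : Type*} [NormedAddCommGroup W] [NormedSpace ℝ W] {f g : M → W} {x : M}
    (h : f =ᶠ[nhds x] g) (X : TangentSpace (𝓡 2) x) : dirDeriv f x X = dirDeriv g x X := by
  rw [dirDeriv, dirDeriv, h.mfderiv_eq]
  rfl

theorem dirDeriv_neg {W : Type*} [NormedAddCommGroup W] [NormedSpace ℝ W] {f : M → W} {x : M}
    (X : TangentSpace (𝓡 2) x) : dirDeriv (fun y => -f y) x X = -dirDeriv f x X := by
  have h := mfderiv_neg (I := 𝓡 2) (f := f) (x := x)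
  exact congrArg (fun L : Eu 2 →L[ℝ] W => L X) h

variable [RiemannianBundle (fun x : M => TangentSpace (𝓡 2) x)]

/-- On a surface a 2-form is determined by its value on an orthonormal frame. -/
theorem dForm_eq_det {W : Type*} [NormedAddCommGroup W] [NormedSpace ℝ W]
    {α : ∀ x : M, TangentSpace (𝓡 2) x →L[ℝ] W} {x : M}
    (hα : DifferentiableAt ℝ (inChart α x) (extChartAt (𝓡 2) x x))
    (b : OrthonormalBasis (Fin 2) ℝ (TangentSpace (𝓡 2) x)) (X Y : TangentSpace (𝓡 2) x) :
    dForm α x X Y = (inner ℝ (b 0) X * inner ℝ (b 1) Y - inner ℝ (b 1) X * inner ℝ (b 0) Y) •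
      dForm α x (b 0) (b 1) := by
  have hX := b.sum_repr' X
  have hY := b.sum_repr' Y
  rw [Fin.sum_univ_two] at hX hY
  have key : ∀ (L : Eu 2 →L[ℝ] Eu 2 →L[ℝ] W) (A : Eu 2 →L[ℝ] Eu 2) (b₀ b₁ : Eu 2) (p q r s : ℝ),
      L (A (p • b₀ + q • b₁)) (A (r • b₀ + s • b₁)) -
        L (A (r • b₀ + s • b₁)) (A (p • b₀ + q • b₁)) =
      (p * s - q * r) • (L (A b₀) (A b₁) - L (A b₁) (A b₀)) := by
    intro L A b₀ b₁ p q r s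
    simp only [map_add, map_smul, add_apply, smul_apply]
    module
  rw [dForm_eq_fderiv hα, dForm_eq_fderiv hα]
  conv_lhs => rw [← hX, ← hY]
  exact key _ (mfderiv (𝓡 2) 𝓘(ℝ, Eu 2) (extChartAt (𝓡 2) x) x) (b 0) (b 1) _ _ _ _

/-- The analogue of `dForm_eq_det` for `dz ∧ dz̄`. -/
theorem dzdzbar_eq_det (z : M → ℂ) {x : M}
    (b : OrthonormalBasis (Fin 2) ℝ (TangentSpace (𝓡 2) x)) (X Y : TangentSpace (𝓡 2) x) :
    dzdzbar z x X Y =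
      ((inner ℝ (b 0) X * inner ℝ (b 1) Y - inner ℝ (b 1) X * inner ℝ (b 0) Y : ℝ) : ℂ) *
      dzdzbar z x (b 0) (b 1) := by
  have hL : ∀ X, dirDeriv z x X = (inner ℝ (b 0) X : ℝ) * dirDeriv z x (b 0) +
      (inner ℝ (b 1) X : ℝ) * dirDeriv z x (b 1) := by
    intro X
    have hX := b.sum_repr' X
    rw [Fin.sum_univ_two] at hX
    have key : ∀ (A : Eu 2 →L[ℝ] ℂ) (b₀ b₁ : Eu 2) (p q : ℝ),
        A (p • b₀ + q • b₁) = p * A b₀ + q * A b₁ := by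
      intro A b₀ b₁ p q
      simp
    conv_lhs => rw [← hX]
    exact key _ _ _ _ _
  rw [dzdzbar, hL X, hL Y, dzdzbar]
  simp only [map_add, map_mul, Complex.conj_ofReal]
  push_cast
  ring

end Derivatives

section XiForms

variable {M : Type*} [TopologicalSpace M] [ChartedSpace (Eu 2) M] [IsManifold (𝓡 2) ∞ M]
  [RiemannianBundle (fun x : M => TangentSpace (𝓡 2) x)]
  [IsContMDiffRiemannianBundle (𝓡 2) ∞ (Eu 2) (fun x : M => TangentSpace (𝓡 2) x)]
  {oM : ∀ x : M, Orientation ℝ (TangentSpace (𝓡 2) x) (Fin 2)}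
  {q : ℕ} {E : M → Type*} [TopologicalSpace (TotalSpace (Eu q) E)]
  [∀ x, NormedAddCommGroup (E x)] [∀ x, InnerProductSpace ℝ (E x)] [FiberBundle (Eu q) E]
  {oE : ∀ x : M, Orientation ℝ (E x) (Fin q)}
  {SM : SpinStructure 2 (fun x : M => TangentSpace (𝓡 2) x) oM} {SE : SpinStructure q E oE}

namespace SpinorField

variable (φ : SpinorField SM SE)

omit [IsContMDiffRiemannianBundle (𝓡 2) ∞ (Eu 2) (fun x : M => TangentSpace (𝓡 2) x)] in
theorem xiTilde_frame_zero {x : M} (u : SM.P x) :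
    φ.xiTilde x (SM.frame u 0) = toC (2 + q) (φ.xi x (SM.frame u 0, 0)) -
      Complex.I • toC (2 + q) (φ.xi x (SM.frame u 1, 0)) := by
  rw [xiTilde_apply, J_frame_zero _ (SM.frame_orientation u)]

omit [IsContMDiffRiemannianBundle (𝓡 2) ∞ (Eu 2) (fun x : M => TangentSpace (𝓡 2) x)] in
theorem xiTilde_frame_one {x : M} (u : SM.P x) :
    φ.xiTilde x (SM.frame u 1) = toC (2 + q) (φ.xi x (SM.frame u 1, 0)) -
      Complex.I • toC (2 + q) (-φ.xi x (SM.frame u 0, 0)) := by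
  rw [xiTilde_apply, J_frame_one _ (SM.frame_orientation u), ← map_neg (φ.xi x)]
  simp

theorem isSmoothForm_xiTilde : IsSmoothForm φ.xiTilde := by
  refine isSmoothForm_of_apply_vectorField fun V x hV => ?_
  obtain ⟨s, U₁, hs, hx₁⟩ := SM.exists_isLocalFrame x
  obtain ⟨t, U₂, ht, hx₂⟩ := SE.exists_isLocalFrame x
  have hs' := hs.mono (hs.isOpen.inter ht.isOpen) Set.inter_subset_left
  have ht' := ht.mono (hs.isOpen.inter ht.isOpen) Set.inter_subset_right
  have hx : x ∈ U₁ ∩ U₂ := ⟨hx₁, hx₂⟩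
  have h0 := φ.contMDiffAt_xi_frame hs' ht' hx 0
  have h1 := φ.contMDiffAt_xi_frame hs' ht' hx 1
  have hc : ∀ a, ContMDiffAt (𝓡 2) 𝓘(ℝ, ℝ) ∞ (fun y => inner ℝ (SM.frame (s y) a) (V y)) x :=
    fun a => ContMDiffAt.inner_bundle ((hs.smooth a).contMDiffAt (hs.isOpen.mem_nhds hx₁)) hV
  refine (((hc 0).smul (contMDiffAt_toC_sub h0 h1)).add
    ((hc 1).smul (contMDiffAt_toC_sub h1 h0.neg))).congr_of_eventuallyEq
      (Filter.Eventually.of_forall fun y => ?_)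
  have hV' := (SM.frame (s y)).sum_repr' (V y)
  rw [Fin.sum_univ_two] at hV'
  have e : φ.xiTilde y (V y) = φ.xiTilde y (inner ℝ (SM.frame (s y) 0) (V y) • SM.frame (s y) 0 +
      inner ℝ (SM.frame (s y) 1) (V y) • SM.frame (s y) 1) := congrArg _ hV'.symm
  change φ.xiTilde y (V y) = _
  rw [e, map_add, map_smul, map_smul, xiTilde_frame_zero, xiTilde_frame_one]
  rfl

theorem differentiableAt_inChart_xiTilde (x : M) :
    DifferentiableAt ℝ (inChart φ.xiTilde x) (extChartAt (𝓡 2) x x) :=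
  ((φ.isSmoothForm_xiTilde x).contDiffAt (extChartAt_target_mem_nhds x)).differentiableAt
    (by decide)

variable [VectorBundle ℝ (Eu q) E] [ContMDiffVectorBundle 1 (Eu q) E (𝓡 2)]
  [IsContMDiffRiemannianBundle (𝓡 2) 1 (Eu q) E]
  {covM : CovariantDerivative (𝓡 2) (Eu 2) (fun x : M => TangentSpace (𝓡 2) x)}
  {covE : CovariantDerivative (𝓡 2) (Eu q) E}
  {B : ∀ x : M, TangentSpace (𝓡 2) x →ₗ[ℝ] TangentSpace (𝓡 2) x →ₗ[ℝ] E x}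

/-- The exterior derivative of `ξ̃` is `2i ⟨⟨H · φ, φ⟩⟩` times the area form: the connection terms
cancel since `∇` has no torsion and commutes with `J`, and those of `B` add up to its trace. -/
theorem IsKilling.dForm_xiTilde_frame {φ : SpinorField SM SE} (hφ : φ.IsKilling covM covE B)
    (hM : covM.IsMetricCompatible) (hT : covM.torsion = 0) (hE : covE.IsMetricCompatible)
    (hB : ∀ (x : M) (X Y : TangentSpace (𝓡 2) x), B x X Y = B x Y X) (x : M) :
    ∃ b : OrthonormalBasis (Fin 2) ℝ (TangentSpace (𝓡 2) x), b.toBasis.orientation = oM x ∧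
      dForm φ.xiTilde x (b 0) (b 1) =
        (2 * Complex.I) • toC (2 + q) (φ.xi x (0, meanCurvature B x)) := by
  obtain ⟨s, U₁, hs, hx₁⟩ := SM.exists_isLocalFrame x
  obtain ⟨t, U₂, ht, hx₂⟩ := SE.exists_isLocalFrame x
  have hs' := hs.mono (hs.isOpen.inter ht.isOpen) Set.inter_subset_left
  have ht' := ht.mono (hs.isOpen.inter ht.isOpen) Set.inter_subset_right
  have hx : x ∈ U₁ ∩ U₂ := ⟨hx₁, hx₂⟩
  refine ⟨SM.frame (s x), SM.frame_orientation _, ?_⟩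
  have h0 := φ.contMDiffAt_xi_frame hs' ht' hx 0
  have h1 := φ.contMDiffAt_xi_frame hs' ht' hx 1
  have he : ∀ a, ContMDiffAt (𝓡 2) ((𝓡 2).prod 𝓘(ℝ, Eu 2)) 1
      (fun y => TotalSpace.mk' (Eu 2) y (SM.frame (s y) a)) x := fun a =>
    ((hs.smooth a).contMDiffAt (hs.isOpen.mem_nhds hx₁)).of_le (by norm_cast)
  have hD : ∀ a X, dirDeriv (fun y => φ.xi y (SM.frame (s y) a, 0)) x X =
      φ.xi x (covM (fun y => SM.frame (s y) a) x X, B x X (SM.frame (s x) a)) := fun a X =>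
    hφ.dirDeriv_xi_frame hM hE hs' ht' hx a X
  have hbr := covM.torsion_apply ((he 0).mdifferentiableAt (by decide))
    ((he 1).mdifferentiableAt (by decide))
  rw [hT] at hbr
  have hbr' : VectorField.mlieBracket (𝓡 2) (fun y => SM.frame (s y) 0) (fun y => SM.frame (s y) 1)
      x = covM (fun y => SM.frame (s y) 1) x (SM.frame (s x) 0) -
        covM (fun y => SM.frame (s y) 0) x (SM.frame (s x) 1) := by
    rw [eq_comm, ← sub_eq_zero]
    exact hbr.symm
  -- `∇` commutes with `J`
  have hexp : ∀ a X, covM (fun y => SM.frame (s y) a) x X =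
      (inner ℝ (covM (fun y => SM.frame (s y) a) x X) (SM.frame (s x) 0) : ℝ) • SM.frame (s x) 0 +
      (inner ℝ (covM (fun y => SM.frame (s y) a) x X) (SM.frame (s x) 1) : ℝ) •
        SM.frame (s x) 1 := by
    intro a X
    have h := (SM.frame (s x)).sum_repr' (covM (fun y => SM.frame (s y) a) x X)
    rw [Fin.sum_univ_two, real_inner_comm, real_inner_comm _ (SM.frame (s x) 1)] at h
    exact h.symm
  have hJ0 : ∀ X, J oM x (covM (fun y => SM.frame (s y) 0) x X) =
      covM (fun y => SM.frame (s y) 1) x X := by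
    intro X
    have a00 := inner_cov_frame_antisymm hM hs hx₁ X 0 0
    have a11 := inner_cov_frame_antisymm hM hs hx₁ X 1 1
    have a01 := inner_cov_frame_antisymm hM hs hx₁ X 0 1
    rw [self_eq_neg] at a00 a11
    rw [hexp 0 X, hexp 1 X, a00, a11, a01, map_add, map_smul, map_smul,
      J_frame_one _ (SM.frame_orientation _)]
    module
  have hJ1 : ∀ X, J oM x (covM (fun y => SM.frame (s y) 1) x X) =
      -covM (fun y => SM.frame (s y) 0) x X := fun X => by rw [← hJ0, J_J]
  rw [dForm_apply_vectorField (φ.differentiableAt_inChart_xiTilde x) (he 0) (he 1), hbr']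
  have e1 := dirDeriv_congr (x := x) (Filter.Eventually.of_forall fun y =>
    SpinorField.xiTilde_frame_one φ (s y)) (SM.frame (s x) 0)
  have e0 := dirDeriv_congr (x := x) (Filter.Eventually.of_forall fun y =>
    SpinorField.xiTilde_frame_zero φ (s y)) (SM.frame (s x) 1)
  rw [e1, e0, dirDeriv_toC_sub h1 h0.neg, dirDeriv_toC_sub h0 h1, dirDeriv_neg, hD, hD, hD, hD,
    xiTilde_apply, map_sub, hJ1, hJ0, hB x (SM.frame (s x) 1) (SM.frame (s x) 0)]
  have hH : (2 * Complex.I) • toC (2 + q) (φ.xi x (0, meanCurvature B x)) =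
      Complex.I • toC (2 + q) (φ.xi x (0, B x (SM.frame (s x) 0) (SM.frame (s x) 0) +
        B x (SM.frame (s x) 1) (SM.frame (s x) 1))) := by
    rw [← two_smul_meanCurvature B (SM.frame (s x)), mul_comm, mul_smul]
    congr 1
    have : ((0 : TangentSpace (𝓡 2) x), (2 : ℝ) • meanCurvature B x) =
      (2 : ℝ) • ((0 : TangentSpace (𝓡 2) x), meanCurvature B x) := by simp
    rw [this, map_smul, map_smul, ← Complex.coe_smul]
    norm_num
  rw [hH]
  -- the rest is linear algebra in the values of `ξ`
  generalize covM (fun y => SM.frame (s y) 0) x (SM.frame (s x) 0) = n00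
  generalize covM (fun y => SM.frame (s y) 0) x (SM.frame (s x) 1) = n01
  generalize covM (fun y => SM.frame (s y) 1) x (SM.frame (s x) 0) = n10
  generalize covM (fun y => SM.frame (s y) 1) x (SM.frame (s x) 1) = n11
  have hadd : ∀ (X : TangentSpace (𝓡 2) x) (Z : E x),
      toC (2 + q) (φ.xi x (X, Z)) = toC (2 + q) (φ.xi x (X, 0)) + toC (2 + q) (φ.xi x (0, Z)) := by
    intro X Z
    rw [← map_add, ← map_add]
    simp
  have hX : ∀ X Y : TangentSpace (𝓡 2) x, toC (2 + q) (φ.xi x (X - Y, 0)) =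
      toC (2 + q) (φ.xi x (X, 0)) - toC (2 + q) (φ.xi x (Y, 0)) := by
    intro X Y
    rw [← map_sub, ← map_sub]
    simp
  have hX' : ∀ X : TangentSpace (𝓡 2) x, toC (2 + q) (φ.xi x (-X, 0)) =
      -toC (2 + q) (φ.xi x (X, 0)) := by
    intro X
    rw [← map_neg, ← map_neg]
    simp
  have hZ : ∀ Z Z' : E x, toC (2 + q) (φ.xi x (0, Z + Z')) =
      toC (2 + q) (φ.xi x (0, Z)) + toC (2 + q) (φ.xi x (0, Z')) := by
    intro Z Z'
    rw [← map_add, ← map_add]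
    simp
  rw [map_neg, hadd n10, hadd n00, hadd n01, hadd n11, hZ, hX, hX, hX']
  module

end SpinorField
end XiForms

/-! ### Closedness, holomorphy and primitives of `ξ̃` -/

section Conclusions

variable {M : Type*} [TopologicalSpace M] [ChartedSpace (Eu 2) M] [IsManifold (𝓡 2) ∞ M]
  [RiemannianBundle (fun x : M => TangentSpace (𝓡 2) x)]
  {oM : ∀ x : M, Orientation ℝ (TangentSpace (𝓡 2) x) (Fin 2)}

omit [IsManifold (𝓡 2) ∞ M] in
/-- `μ² dz ∧ dz̄` is `-2i` times the area form. -/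
theorem IsComplexParameter.sq_mul_dzdzbar_frame {z : OpenPartialHomeomorph M ℂ} {μ : M → ℝ}
    (hz : IsComplexParameter oM z) (hμ : IsConformalFactor z μ) {x : M} (hx : x ∈ z.source)
    (b : OrthonormalBasis (Fin 2) ℝ (TangentSpace (𝓡 2) x)) (hb : b.toBasis.orientation = oM x) :
    (μ x : ℂ) ^ 2 * dzdzbar z x (b 0) (b 1) = -(2 * Complex.I) := by
  have h1 : dirDeriv z x (b 1) = Complex.I * dirDeriv z x (b 0) := by
    rw [← hz.mfderiv_J x hx, J_frame_zero b hb]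
  have h2 := hμ x hx (b 0) (b 0)
  rw [real_inner_self_eq_norm_sq, b.norm_eq_one, Complex.mul_conj, Complex.ofReal_re] at h2
  have h3 : (μ x : ℂ) ^ 2 * (Complex.normSq (dirDeriv z x (b 0)) : ℂ) = 1 := by
    rw [← Complex.ofReal_pow, ← Complex.ofReal_mul, ← h2]
    norm_num
  rw [← Complex.mul_conj] at h3
  rw [dzdzbar, h1, map_mul, Complex.conj_I]
  linear_combination (-(2 * Complex.I)) * h3

theorem IsClosedForm.isHolomorphicForm {n : ℕ}
    {α : ∀ x : M, TangentSpace (𝓡 2) x →L[ℝ] Ec n} (hα : IsClosedForm α)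
    (hJ : ∀ x X, α x (J oM x X) = Complex.I • α x X) : IsHolomorphicForm oM α := fun _ hz =>
  ⟨fun _ hw => (hz.differentiableAt_coeff hJ hα hw).differentiableWithinAt,
    fun _ hx X => hz.eq_dirDeriv_smul_coeff hJ hx X⟩

namespace SpinorField

variable [IsContMDiffRiemannianBundle (𝓡 2) ∞ (Eu 2) (fun x : M => TangentSpace (𝓡 2) x)]
  {q : ℕ} {E : M → Type*} [TopologicalSpace (TotalSpace (Eu q) E)]
  [∀ x, NormedAddCommGroup (E x)] [∀ x, InnerProductSpace ℝ (E x)] [FiberBundle (Eu q) E]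
  [VectorBundle ℝ (Eu q) E] [ContMDiffVectorBundle 1 (Eu q) E (𝓡 2)]
  [IsContMDiffRiemannianBundle (𝓡 2) 1 (Eu q) E]
  {oE : ∀ x : M, Orientation ℝ (E x) (Fin q)}
  {SM : SpinStructure 2 (fun x : M => TangentSpace (𝓡 2) x) oM} {SE : SpinStructure q E oE}
  {covM : CovariantDerivative (𝓡 2) (Eu 2) (fun x : M => TangentSpace (𝓡 2) x)}
  {covE : CovariantDerivative (𝓡 2) (Eu q) E}
  {B : ∀ x : M, TangentSpace (𝓡 2) x →ₗ[ℝ] TangentSpace (𝓡 2) x →ₗ[ℝ] E x}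
  {φ : SpinorField SM SE}

theorem IsKilling.dForm_xiTilde_eq (hφ : φ.IsKilling covM covE B)
    (hM : covM.IsMetricCompatible) (hT : covM.torsion = 0) (hE : covE.IsMetricCompatible)
    (hB : ∀ (x : M) (X Y : TangentSpace (𝓡 2) x), B x X Y = B x Y X)
    {z : OpenPartialHomeomorph M ℂ} {μ : M → ℝ} (hz : IsComplexParameter oM z)
    (hμ : IsConformalFactor z μ) {x : M} (hx : x ∈ z.source) (X Y : TangentSpace (𝓡 2) x) :
    dForm φ.xiTilde x X Y =
      -(((μ x : ℂ) ^ 2 * dzdzbar z x X Y) • toC (2 + q) (φ.xi x (0, meanCurvature B x))) := by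
  obtain ⟨b, hb, h⟩ := hφ.dForm_xiTilde_frame hM hT hE hB x
  have hμz := hz.sq_mul_dzdzbar_frame hμ hx b hb
  rw [dForm_eq_det (φ.differentiableAt_inChart_xiTilde x) b, h, dzdzbar_eq_det z b X Y,
    mul_left_comm, hμz, ← neg_smul, ← Complex.coe_smul, smul_smul]
  congr 1
  ring

theorem IsKilling.isClosedForm_xiTilde_iff (hφ : φ.IsKilling covM covE B) (hu : φ.IsUnit)
    (hM : covM.IsMetricCompatible) (hT : covM.torsion = 0) (hE : covE.IsMetricCompatible)
    (hB : ∀ (x : M) (X Y : TangentSpace (𝓡 2) x), B x X Y = B x Y X) :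
    IsClosedForm φ.xiTilde ↔ ∀ x, meanCurvature B x = 0 := by
  constructor
  · intro hc x
    obtain ⟨b, -, h⟩ := hφ.dForm_xiTilde_frame hM hT hE hB x
    rw [hc.2, eq_comm, smul_eq_zero_iff_right (by simp)] at h
    have h1 : φ.xi x (0, meanCurvature B x) = 0 :=
      toC_injective _ (h.trans (map_zero _).symm)
    exact congrArg Prod.snd (φ.eq_zero_of_xi_eq_zero hu h1)
  · refine fun hH => ⟨φ.isSmoothForm_xiTilde, fun x X Y => ?_⟩
    obtain ⟨b, -, h⟩ := hφ.dForm_xiTilde_frame hM hT hE hB x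
    have h0 : ((0 : TangentSpace (𝓡 2) x), (0 : E x)) = 0 := rfl
    rw [dForm_eq_det (φ.differentiableAt_inChart_xiTilde x) b, h, hH, h0, map_zero (φ.xi x),
      map_zero (toC (2 + q)), smul_zero, smul_zero]

omit [IsContMDiffRiemannianBundle (𝓡 2) ∞ (Eu 2) (fun x : M => TangentSpace (𝓡 2) x)]
  [VectorBundle ℝ (Eu q) E] [ContMDiffVectorBundle 1 (Eu q) E (𝓡 2)]
  [IsContMDiffRiemannianBundle (𝓡 2) 1 (Eu q) E] in
/-- `Re G` is a primitive of `ξ = Re ξ̃`, and primitives differ by a constant. -/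
theorem exists_eq_const_add_reC [PreconnectedSpace M] [Nonempty M]
    {G : M → Ec (2 + q)} (hG : IsPrimitiveOn G φ.xiTilde Set.univ) {F : M → Eu (2 + q)}
    (hF : IsPrimitiveOn F φ.xiForm Set.univ) : ∃ c : Eu (2 + q), ∀ x, F x = c + reC (G x) := by
  have hD : ∀ y, HasMFDerivAt (𝓡 2) 𝓘(ℝ, Eu (2 + q)) (F - reCL (2 + q) ∘ G) y
      (0 : TangentSpace (𝓡 2) y →L[ℝ] Eu (2 + q)) := by
    intro y
    have h1 := HasMFDerivAt.comp y (reCL (2 + q)).hasFDerivAt.hasMFDerivAt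
      (hG y (Set.mem_univ y))
    refine ((hF y (Set.mem_univ y)).sub h1).congr_mfderiv ?_
    ext1 X
    exact sub_eq_zero.2 (φ.reC_xiTilde y X).symm
  obtain ⟨x₀⟩ := ‹Nonempty M›
  refine ⟨F x₀ - reC (G x₀), fun x => ?_⟩
  have h := eq_const_of_hasMFDerivAt_zero hD x x₀
  have h' : F x - reC (G x) = F x₀ - reC (G x₀) := h
  rw [← h', sub_add_cancel]

end SpinorField

end Conclusions

end SpinSurface

end

open scoped Manifold ContDiff Bundle in
open Bundle SpinSurface in
theorem mainTheorem8
    -- an oriented Riemannian surface `M` with a spin structure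
    {M : Type*} [TopologicalSpace M] [ChartedSpace (Eu 2) M] [IsManifold (𝓡 2) ∞ M]
    [RiemannianBundle (fun x : M => TangentSpace (𝓡 2) x)]
    [IsContMDiffRiemannianBundle (𝓡 2) ∞ (Eu 2) (fun x : M => TangentSpace (𝓡 2) x)]
    (oM : ∀ x : M, Orientation ℝ (TangentSpace (𝓡 2) x) (Fin 2))
    (SM : SpinStructure 2 (fun x : M => TangentSpace (𝓡 2) x) oM)
    -- an oriented Riemannian vector bundle `E` of rank `q` with a spin structure
    {q : ℕ} {E : M → Type*} [TopologicalSpace (TotalSpace (Eu q) E)]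
    [∀ x, NormedAddCommGroup (E x)] [∀ x, InnerProductSpace ℝ (E x)]
    [FiberBundle (Eu q) E] [VectorBundle ℝ (Eu q) E] [ContMDiffVectorBundle ∞ (Eu q) E (𝓡 2)]
    [IsContMDiffRiemannianBundle (𝓡 2) ∞ (Eu q) E]
    (oE : ∀ x : M, Orientation ℝ (E x) (Fin q))
    (SE : SpinStructure q E oE)
    -- the Levi-Civita connection of `M` and a compatible connection on `E`
    (covM : CovariantDerivative (𝓡 2) (Eu 2) (fun x : M => TangentSpace (𝓡 2) x))
    (covM_metric : covM.IsMetricCompatible) (covM_torsion : covM.torsion = 0)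
    (covE : CovariantDerivative (𝓡 2) (Eu q) E) (covE_metric : covE.IsMetricCompatible)
    -- a symmetric bilinear `B : TM × TM → E` and `φ ∈ Γ(UΣ)` solving the Killing type equation
    (B : ∀ x : M, TangentSpace (𝓡 2) x →ₗ[ℝ] TangentSpace (𝓡 2) x →ₗ[ℝ] E x)
    (B_symm : ∀ (x : M) (X Y : TangentSpace (𝓡 2) x), B x X Y = B x Y X)
    (φ : SpinorField SM SE) (φ_unit : φ.IsUnit) (φ_killing : φ.IsKilling covM covE B) :
    -- `ξ̃` is smooth and `ℂ`-linear
    IsSmoothForm φ.xiTilde ∧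
    (∀ (x : M) (X : TangentSpace (𝓡 2) x),
      φ.xiTilde x (J oM x X) = Complex.I • φ.xiTilde x X) ∧
    -- `dξ̃ = -μ² ⟨⟨H · φ, φ⟩⟩ dz ∧ dz̄`
    (∀ (z : OpenPartialHomeomorph M ℂ) (μ : M → ℝ),
      IsComplexParameter oM z → IsConformalFactor z μ →
      ∀ x ∈ z.source, ∀ X Y : TangentSpace (𝓡 2) x,
        dForm φ.xiTilde x X Y =
          -(((μ x : ℂ) ^ 2 * dzdzbar z x X Y) • toC (2 + q) (φ.xi x (0, meanCurvature B x)))) ∧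
    -- `ξ̃` is closed if and only if `H = 0`, and it is then holomorphic
    (IsClosedForm φ.xiTilde ↔ ∀ x, meanCurvature B x = 0) ∧
    (IsClosedForm φ.xiTilde → IsHolomorphicForm oM φ.xiTilde) ∧
    -- if `H = 0`, then `F = Re ∫ f̃ dz` in each complex parameter `z`, with `f̃` holomorphic
    ((∀ x, meanCurvature B x = 0) →
      ∀ z : OpenPartialHomeomorph M ℂ, IsComplexParameter oM z →
        DifferentiableOn ℂ (coeff φ.xiTilde z) z.target ∧
        ∀ F : M → Eu (2 + q), IsPrimitiveOn F φ.xiForm z.source →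
          ∀ (a b : ℂ) (γ : Path a b), (∀ t, γ t ∈ z.target) →
            ContDiffOn ℝ 1 γ.extend (Set.Icc 0 1) →
            F (z.symm b) = F (z.symm a) + reC (curveIntegral
              (fun w => (ContinuousLinearMap.id ℂ ℂ).smulRight (coeff φ.xiTilde z w)) γ)) ∧
    -- if moreover `M` is simply connected, then `∫ f̃ dz` is a global holomorphic map `G` on `M`
    ((∀ x, meanCurvature B x = 0) → SimplyConnectedSpace M →
      ∃ G : M → Ec (2 + q), IsPrimitiveOn G φ.xiTilde Set.univ ∧
        (∀ z : OpenPartialHomeomorph M ℂ, IsComplexParameter oM z →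
          ∀ w ∈ z.target, HasDerivAt (fun w' => G (z.symm w')) (coeff φ.xiTilde z w) w) ∧
        ∀ F : M → Eu (2 + q), IsPrimitiveOn F φ.xiForm Set.univ →
          ∃ c : Eu (2 + q), ∀ x, F x = c + reC (G x)) := by
  have hJ := φ.xiTilde_J
  have hcl := φ_killing.isClosedForm_xiTilde_iff φ_unit covM_metric covM_torsion covE_metric B_symm
  refine ⟨φ.isSmoothForm_xiTilde, hJ,
    fun z μ hz hμ x hx X Y => φ_killing.dForm_xiTilde_eq covM_metric covM_torsion covE_metric B_symm
      hz hμ hx X Y, hcl, fun hc => hc.isHolomorphicForm hJ, fun hH z hz => ?_, fun hH _ => ?_⟩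
  · have hd := ((hcl.2 hH).isHolomorphicForm hJ z hz).1
    exact ⟨hd, fun F hF a b γ hγ hγ' =>
      hz.primitive_eq_curveIntegral hJ φ.reC_xiTilde hd.continuousOn hF γ hγ hγ'⟩
  · obtain ⟨G, hG⟩ := exists_primitive_of_local (hcl.2 hH).exists_local_primitive
    exact ⟨G, hG, fun z hz w hw => hz.hasDerivAt_primitive hJ hw (hG _ (Set.mem_univ _)),
      fun F hF => SpinorField.exists_eq_const_add_reC hG hF⟩
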